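/- **Conventions.** Composition is written $f;g$ in diagrammatic order. A *pointed convex algebra* (pca) is a set $X$ with a point $\star\in X$ and operations $+_p$ for $p\in(0,1)$ such that $(x+_q y)+_p z = x+_{\tilde p}(y+_{\tilde q}z)$ with $\tilde p=pq$, $\tilde q=\frac{p(1-q)}{1-pq}$, $x+_py=y+_{1-p}x$ and $x+_px=x$. Put $p\cdot x = x+_p\star$ for $p\in(0,1)$, $1\cdot x=x$, $0\cdot x=\star$. A category is *PCA-enriched* if its hom-sets are pcas and composition preserves $+_p$ and $\star$ in each variable; a functor is PCA-enriched if it preserves $+_p$ and $\star$ on each hom-set. A *convex product* of $X_1,X_2$ is an object $Z$ with $\pi_i\colon Z\to X_i$ such that for all $p_1,p_2\in[0,1]$ with $p_1+p_2\le1$ and all $f_i\colon A\to X_i$ there is a unique $h\colon A\to Z$ with $h;\pi_i=p_i\cdot f_i$ for $i=1,2$. A *convex biproduct category* is a PCA-enriched category with an object that is both initial and final and in which any two objects $X_1,X_2$ have an object $X_1\oplus X_2$ with maps $\iota_i\colon X_i\to X_1\oplus X_2$ forming a coproduct and maps $\pi_i\colon X_1\oplus X_2\to X_i$ forming a convex product,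 such that $\iota_i;\pi_i=\mathrm{id}$ and $\iota_i;\pi_j=\star$ for $i\ne j$. A *morphism* of convex biproduct categories is a PCA-enriched functor preserving finite coproducts. These form the category $\mathbf{CBCat}$. A convex biproduct category is *strict* if it is equipped with a chosen initial object $0$ and chosen binary coproducts whose canonical unitors and associators are identities; a *strict morphism* is a PCA-enriched functor preserving $0$, the objects $X\oplus Y$ and the injections on the nose. These form the category $\mathbf{CBCat}_{\mathrm{str}}$. For a category $\mathcal C$, the category $\mathcal T(\mathcal C)$ has as objects the finite words of objects of $\mathcal C$ ($\oplus$ is concatenation, $0$ the empty word). Its arrows $P\to Q$ are the well-typed terms generated from $\lhd_p^U\colon U\to U\oplus U$ ($p\in(0,1)$), $!_U\colon U\to0$, $\underline{c}\colon U\to V$ for each arrow $c\colon U\to V$ of $\mathcal C$, $?_U\colon 0\to U$, $\rhd_U\colon U\oplus U\to U$, $\mathrm{id}_U$, $\mathrm{id}_0$ and $\sigma_{U,V}\colon U\oplus V\to V\oplus U$ (for objects $U,V$ of $\mathcal C$) by composition $;$ and sum $\oplus$. On words, these structure maps are defined inductively by $\mathrm{id}_{U\oplus P}=\mathrm{id}_U\oplus\mathrm{id}_P$,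 $!_{U\oplus P}=\,!_U\oplus{!_P}$, $?_{U\oplus P}=\,?_U\oplus{?_P}$, $\lhd_p^{U\oplus P}=(\lhd_p^U\oplus\lhd_p^P);(\mathrm{id}_U\oplus\sigma_{U,P}\oplus\mathrm{id}_P)$, $\rhd_{U\oplus P}=(\mathrm{id}_U\oplus\sigma_{P,U}\oplus\mathrm{id}_P);(\rhd_U\oplus\rhd_P)$ (each being $\mathrm{id}_0$ on the empty word), and analogously for $\sigma_{P,Q}$. Terms are taken modulo the congruence generated by * the axioms of strict symmetric monoidal categories (with tensor $\oplus$, unit $0$, symmetry $\sigma$); * for all words $P,Q$ and all $f\colon P\to Q$: $(\mathrm{id}_P\oplus\rhd_P);\rhd_P=(\rhd_P\oplus\mathrm{id}_P);\rhd_P$, $(?_P\oplus\mathrm{id}_P);\rhd_P=\mathrm{id}_P$, $\sigma_{P,P};\rhd_P=\rhd_P$, $?_{P\oplus Q}=\,?_P\oplus{?_Q}$, $\rhd_{P\oplus Q}=(\mathrm{id}_P\oplus\sigma_{Q,P}\oplus\mathrm{id}_Q);(\rhd_P\oplus\rhd_Q)$, $?_P;f=\,?_Q$, $\rhd_P;f=(f\oplus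 f);\rhd_Q$; * likewise, for $p,q\in(0,1)$ and $\tilde p,\tilde q$ as above: $\lhd_p^P;(\lhd_q^P\oplus\mathrm{id}_P)=\lhd_{\tilde p}^P;(\mathrm{id}_P\oplus\lhd_{\tilde q}^P)$, $\lhd_p^P;\rhd_P=\mathrm{id}_P$, $\lhd_p^P;\sigma_{P,P}=\lhd_{1-p}^P$, $!_{P\oplus Q}=\,!_P\oplus{!_Q}$, $\lhd_p^{P\oplus Q}=(\lhd_p^P\oplus\lhd_p^Q);(\mathrm{id}_P\oplus\sigma_{P,Q}\oplus\mathrm{id}_Q)$, $f;{!_Q}=\,!_P$, $f;\lhd_p^Q=\lhd_p^P;(f\oplus f)$; * $\underline{\mathrm{id}_U}=\mathrm{id}_U$ and $\underline{c;d}=\underline c;\underline d$. $\mathcal T(\mathcal C)$ is PCA-enriched by $f+_pg=\lhd_p^P;(f\oplus g);\rhd_Q$ and $\star_{P,Q}=\,!_P;{?_Q}$, and concatenation with injections $\mathrm{id}_P\oplus{?_Q}$ and $?_P\oplus\mathrm{id}_Q$ is a strict choice of coproducts. A functor $F\colon\mathcal C\to\mathcal D$ induces $\mathcal T(F)\colon\mathcal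 T(\mathcal C)\to\mathcal T(\mathcal D)$ by applying $F$ to all letters of words and terms, and $\eta_{\mathcal C}\colon\mathcal C\to\mathcal T(\mathcal C)$ is the functor $U\mapsto U$, $c\mapsto\underline c$. **Theorem.** 1. For every category $\mathcal C$, $\mathcal T(\mathcal C)$ is a convex biproduct category, it is locally small if $\mathcal C$ is, and $\mathcal C\mapsto\mathcal T(\mathcal C)$, $F\mapsto\mathcal T(F)$ is a functor $\mathcal T\colon\mathbf{Cat}\to\mathbf{CBCat}$, which factors through $\mathbf{CBCat}_{\mathrm{str}}$. 2. $\mathcal T$ is left adjoint to the forgetful functor $U\colon\mathbf{CBCat}\to\mathbf{Cat}$ in the 2-categorical sense, with unit $\eta$: $F;\eta_{\mathcal D}=\eta_{\mathcal C};\mathcal T(F)$ for all $F\colon\mathcal C\to\mathcal D$, and for every category $\mathcal C$ and every convex biproduct category $\mathcal D$, precomposition with $\eta_{\mathcal C}$ is an equivalence from the category of morphisms of convex biproduct categories $\mathcal T(\mathcal C)\to\mathcal D$ (with all natural transformations) to the category of functors $\mathcal C\to U(\mathcal D)$; moreover every functor $F\colon\mathcal C\to U(\mathcal D)$ equals $\eta_{\mathcal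 C};F^\sharp$ for some morphism $F^\sharp$. 3. For strict convex biproduct categories and strict morphisms, $\mathcal T\colon\mathbf{Cat}\to\mathbf{CBCat}_{\mathrm{str}}$ is left adjoint, as an ordinary functor, to the forgetful functor $\mathbf{CBCat}_{\mathrm{str}}\to\mathbf{Cat}$, with unit $\eta$. -/

import Mathlib

open CategoryTheory CategoryTheory.Limits

universe v u w u'

/-! ## Pointed convex algebras -/

/-- The open real interval `(0,1)`. -/
abbrev OpenUnit : Type := Set.Ioo (0 : ℝ) 1

namespace OpenUnit

/-- `p ↦ 1 - p`. -/
def compl (p : OpenUnit) : OpenUnit :=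
  ⟨1 - p.1, by have := p.2.1; have := p.2.2; constructor <;> linarith⟩

/-- `p̃ = p q`. -/
def tildeP (p q : OpenUnit) : OpenUnit :=
  ⟨p.1 * q.1, mul_pos p.2.1 q.2.1, by nlinarith [p.2.1, p.2.2, q.2.1, q.2.2]⟩

/-- `q̃ = p (1 - q) / (1 - p q)`. -/
noncomputable def tildeQ (p q : OpenUnit) : OpenUnit :=
  ⟨p.1 * (1 - q.1) / (1 - p.1 * q.1), by
    have hp := p.2.1; have hp' := p.2.2; have hq := q.2.1; have hq' := q.2.2
    have h : 0 < 1 - p.1 * q.1 := by nlinarith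
    refine ⟨div_pos (mul_pos hp (by linarith)) h, ?_⟩
    rw [div_lt_one h]; nlinarith⟩

end OpenUnit

/-- Pointed convex algebras: a point `star` and operations `x +_p y`, written `conv p x y`,
for `p` in the open interval `(0,1)`. -/
class PCA (X : Type u) where
  star : X
  conv : OpenUnit → X → X → X
  conv_assoc : ∀ (p q : OpenUnit) (x y z : X),
    conv p (conv q x y) z = conv (p.tildeP q) x (conv (p.tildeQ q) y z)
  conv_comm : ∀ (p : OpenUnit) (x y : X), conv p x y = conv p.compl y x
  conv_idem : ∀ (p : OpenUnit) (x : X), conv p x x = x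

/-- Scalar multiplication `p · x = x +_p star` for `p ∈ [0,1]`, where `x +_1 y = x` and
`x +_0 y = y` (it is only used for such `p`). -/
noncomputable def PCA.smul {X : Type u} [PCA X] (p : ℝ) (x : X) : X :=
  open Classical in
  if h : p ∈ Set.Ioo (0 : ℝ) 1 then PCA.conv ⟨p, h⟩ x PCA.star
  else if p ≤ 0 then PCA.star else x

/-- `PCA`-enriched categories: every hom-set is a pointed convex algebra and composition is
compatible with the structure in each variable. -/
class PCAEnriched (C : Type u) [Category.{v} C] where
  pca : ∀ X Y : C, PCA (X ⟶ Y)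
  comp_conv : ∀ {X Y Z : C} (p : OpenUnit) (e : X ⟶ Y) (f g : Y ⟶ Z),
    e ≫ (pca Y Z).conv p f g = (pca X Z).conv p (e ≫ f) (e ≫ g)
  conv_comp : ∀ {X Y Z : C} (p : OpenUnit) (f g : X ⟶ Y) (h : Y ⟶ Z),
    (pca X Y).conv p f g ≫ h = (pca X Z).conv p (f ≫ h) (g ≫ h)
  comp_star : ∀ {X Y Z : C} (f : X ⟶ Y), f ≫ (pca Y Z).star = (pca X Z).star
  star_comp : ∀ {X Y Z : C} (f : Y ⟶ Z), (pca X Y).star ≫ f = (pca X Z).star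

attribute [reducible, instance] PCAEnriched.pca

/-- A functor is `PCA`-enriched if it preserves the structure on each hom-set. -/
structure IsPCAFunctor {C : Type u} [Category.{v} C] [PCAEnriched C]
    {D : Type u'} [Category.{w} D] [PCAEnriched D] (F : C ⥤ D) : Prop where
  map_star : ∀ X Y : C, F.map (PCA.star : X ⟶ Y) = PCA.star
  map_conv : ∀ {X Y : C} (p : OpenUnit) (f g : X ⟶ Y),
    F.map (PCA.conv p f g) = PCA.conv p (F.map f) (F.map g)

theorem IsPCAFunctor.id (C : Type u) [Category.{v} C] [PCAEnriched C] : IsPCAFunctor (𝟭 C) :=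
  ⟨fun _ _ => rfl, fun _ _ _ => rfl⟩

theorem IsPCAFunctor.comp {C D E : Type*} [Category C] [PCAEnriched C] [Category D]
    [PCAEnriched D] [Category E] [PCAEnriched E] {F : C ⥤ D} {G : D ⥤ E}
    (hF : IsPCAFunctor F) (hG : IsPCAFunctor G) : IsPCAFunctor (F ⋙ G) :=
  ⟨fun X Y => by simp [hF.map_star, hG.map_star],
    fun p f g => by simp [hF.map_conv, hG.map_conv]⟩

/-! ## Convex biproduct categories -/

/-- `(Z, π₁, π₂)` is a convex product of `X₁` and `X₂`. -/
def IsConvexProduct {C : Type u} [Category.{v} C] [PCAEnriched C] {Z X₁ X₂ : C}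
    (π₁ : Z ⟶ X₁) (π₂ : Z ⟶ X₂) : Prop :=
  ∀ p₁ p₂ : ℝ, 0 ≤ p₁ → 0 ≤ p₂ → p₁ + p₂ ≤ 1 →
    ∀ (A : C) (f : A ⟶ X₁) (g : A ⟶ X₂),
      ∃! h : A ⟶ Z, h ≫ π₁ = PCA.smul p₁ f ∧ h ≫ π₂ = PCA.smul p₂ g

/-- Convex biproduct categories. -/
class ConvexBiproductCategory (C : Type u) [Category.{v} C] [PCAEnriched C] : Prop where
  exists_zero : ∃ Z : C, Nonempty (IsInitial Z) ∧ Nonempty (IsTerminal Z)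
  exists_biproduct : ∀ X₁ X₂ : C, ∃ (S : C) (ι₁ : X₁ ⟶ S) (ι₂ : X₂ ⟶ S)
    (π₁ : S ⟶ X₁) (π₂ : S ⟶ X₂),
      Nonempty (IsColimit (BinaryCofan.mk ι₁ ι₂)) ∧ IsConvexProduct π₁ π₂ ∧
      ι₁ ≫ π₁ = 𝟙 X₁ ∧ ι₁ ≫ π₂ = PCA.star ∧ ι₂ ≫ π₁ = PCA.star ∧ ι₂ ≫ π₂ = 𝟙 X₂

/-- Being a morphism of convex biproduct categories: a `PCA`-enriched functor that preserves
finite coproducts. -/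
def isCBFunctor (C : Type u) [Category.{v} C] [PCAEnriched C]
    (D : Type u') [Category.{w} D] [PCAEnriched D] : ObjectProperty (C ⥤ D) :=
  fun F => IsPCAFunctor F ∧ PreservesFiniteCoproducts F

/-- The morphisms of convex biproduct categories from `C` to `D`; together with all natural
transformations between them they form a category. -/
abbrev CBFunctor (C : Type u) [Category.{v} C] [PCAEnriched C]
    (D : Type u') [Category.{w} D] [PCAEnriched D] :=
  (isCBFunctor C D).FullSubcategory

/-- Convex biproduct categories as objects of a category. -/
structure CBCat where
  carrier : Type u
  [cat : Category.{v} carrier]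
  [pca : PCAEnriched carrier]
  [cb : ConvexBiproductCategory carrier]

namespace CBCat

attribute [instance] cat pca cb

theorem isCBFunctor_id (C : Type u) [Category.{v} C] [PCAEnriched C] : isCBFunctor C C (𝟭 C) :=
  ⟨.id C, inferInstance⟩

theorem isCBFunctor_comp {C D E : Type*} [Category C] [PCAEnriched C] [Category D]
    [PCAEnriched D] [Category E] [PCAEnriched E] {F : C ⥤ D} {G : D ⥤ E}
    (hF : isCBFunctor C D F) (hG : isCBFunctor D E G) : isCBFunctor C E (F ⋙ G) :=
  ⟨hF.1.comp hG.1, by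
      have := hF.2
      have := hG.2
      exact ⟨fun n => inferInstance⟩⟩

/-- The category of convex biproduct categories and their morphisms. -/
instance : Category CBCat.{v, u} where
  Hom C D := CBFunctor C.carrier D.carrier
  id C := ⟨𝟭 _, isCBFunctor_id _⟩
  comp F G := ⟨F.obj ⋙ G.obj, isCBFunctor_comp F.property G.property⟩

/-- The forgetful functor from convex biproduct categories to categories. -/
def forget : CBCat.{v, u} ⥤ Cat.{v, u} where
  obj C := Cat.of C.carrier
  map F := F.obj.toCatHom

end CBCat

/-! ## Strict convex biproduct categories -/

/-- A strict choice of finite coproducts: an initial object `zero` and binary coproducts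
`sum X Y` such that the canonical unitors and associators are identities. -/
class StrictSums (C : Type u) [Category.{v} C] where
  zero : C
  sum : C → C → C
  inl : ∀ X Y : C, X ⟶ sum X Y
  inr : ∀ X Y : C, Y ⟶ sum X Y
  zero_initial : Nonempty (IsInitial zero)
  sum_coproduct : ∀ X Y : C, Nonempty (IsColimit (BinaryCofan.mk (inl X Y) (inr X Y)))
  zero_sum : ∀ X : C, sum zero X = X
  sum_zero : ∀ X : C, sum X zero = X
  sum_assoc : ∀ X Y Z : C, sum (sum X Y) Z = sum X (sum Y Z)
  inr_zero : ∀ X : C, inr zero X = eqToHom (zero_sum X).symm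
  inl_zero : ∀ X : C, inl X zero = eqToHom (sum_zero X).symm
  inl_inl : ∀ X Y Z : C,
    inl X Y ≫ inl (sum X Y) Z ≫ eqToHom (sum_assoc X Y Z) = inl X (sum Y Z)
  inr_inl : ∀ X Y Z : C,
    inr X Y ≫ inl (sum X Y) Z ≫ eqToHom (sum_assoc X Y Z) = inl Y Z ≫ inr X (sum Y Z)
  inr_inr : ∀ X Y Z : C,
    inr (sum X Y) Z ≫ eqToHom (sum_assoc X Y Z) = inr Y Z ≫ inr X (sum Y Z)

/-- A functor that preserves the chosen coproducts on the nose. -/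
structure IsStrictSumFunctor {C : Type u} [Category.{v} C] [StrictSums C]
    {D : Type u'} [Category.{w} D] [StrictSums D] (F : C ⥤ D) : Prop where
  obj_zero : F.obj StrictSums.zero = StrictSums.zero
  obj_sum : ∀ X Y : C, F.obj (StrictSums.sum X Y) = StrictSums.sum (F.obj X) (F.obj Y)
  map_inl : ∀ X Y : C, F.map (StrictSums.inl X Y) =
    StrictSums.inl (F.obj X) (F.obj Y) ≫ eqToHom (obj_sum X Y).symm
  map_inr : ∀ X Y : C, F.map (StrictSums.inr X Y) =
    StrictSums.inr (F.obj X) (F.obj Y) ≫ eqToHom (obj_sum X Y).symm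

namespace IsStrictSumFunctor

theorem id (C : Type u) [Category.{v} C] [StrictSums C] : IsStrictSumFunctor (𝟭 C) :=
  ⟨rfl, fun _ _ => rfl, fun _ _ => by simp, fun _ _ => by simp⟩

theorem comp {C D E : Type*} [Category C] [StrictSums C] [Category D] [StrictSums D]
    [Category E] [StrictSums E] {F : C ⥤ D} {G : D ⥤ E}
    (hF : IsStrictSumFunctor F) (hG : IsStrictSumFunctor G) : IsStrictSumFunctor (F ⋙ G) where
  obj_zero := by simp [hF.obj_zero, hG.obj_zero]
  obj_sum X Y := by simp [hF.obj_sum, hG.obj_sum]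
  map_inl X Y := by simp [hF.map_inl, hG.map_inl, eqToHom_map]
  map_inr X Y := by simp [hF.map_inr, hG.map_inr, eqToHom_map]

theorem preservesFiniteCoproducts {C : Type u} [Category.{v} C] [StrictSums C]
    {D : Type u'} [Category.{w} D] [StrictSums D] {F : C ⥤ D} (hF : IsStrictSumFunctor F) :
    PreservesFiniteCoproducts F := by
  obtain ⟨hC⟩ := StrictSums.zero_initial (C := C)
  obtain ⟨hD⟩ := StrictSums.zero_initial (C := D)
  have : HasInitial C := hC.hasInitial
  have : HasBinaryCoproducts C := by
    have : ∀ X Y : C, HasBinaryCoproduct X Y := fun X Y =>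
      ⟨⟨⟨_, (StrictSums.sum_coproduct X Y).some⟩⟩⟩
    exact hasBinaryCoproducts_of_hasColimit_pair C
  have : HasFiniteCoproducts C := hasFiniteCoproducts_of_has_binary_and_initial
  have : PreservesColimit (Functor.empty.{0} C) F := by
    apply preservesColimit_of_preserves_colimit_cocone hC
    exact (isColimitMapCoconeEmptyCoconeEquiv F _).symm (hD.ofIso (eqToIso hF.obj_zero.symm))
  have : PreservesColimitsOfShape (Discrete.{0} PEmpty) F :=
    preservesColimitsOfShape_pempty_of_preservesInitial F
  have : PreservesColimitsOfShape (Discrete WalkingPair) F := by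
    have : ∀ X Y : C, PreservesColimit (pair X Y) F := by
      intro X Y
      apply preservesColimit_of_preserves_colimit_cocone (StrictSums.sum_coproduct X Y).some
      refine (isColimitMapCoconeBinaryCofanEquiv F _ _).symm ?_
      refine IsColimit.ofIsoColimit (StrictSums.sum_coproduct (F.obj X) (F.obj Y)).some ?_
      refine BinaryCofan.ext (eqToIso (hF.obj_sum X Y).symm) ?_ ?_
      · exact (hF.map_inl X Y).symm
      · exact (hF.map_inr X Y).symm
    exact ⟨fun {K} => preservesColimit_of_iso_diagram F (diagramIsoPair K).symm⟩
  exact ⟨fun n => PreservesFiniteCoproducts.of_preserves_binary_and_initial F (Fin n)⟩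

end IsStrictSumFunctor

/-- Strict convex biproduct categories. -/
structure StrictCBCat where
  carrier : Type u
  [cat : Category.{v} carrier]
  [pca : PCAEnriched carrier]
  [cb : ConvexBiproductCategory carrier]
  [sums : StrictSums carrier]

namespace StrictCBCat

attribute [instance] cat pca cb sums

/-- Strict convex biproduct categories and `PCA`-enriched functors preserving the chosen
coproducts strictly. -/
instance : Category StrictCBCat.{v, u} where
  Hom C D := {F : C.carrier ⥤ D.carrier // IsPCAFunctor F ∧ IsStrictSumFunctor F}
  id C := ⟨𝟭 _, .id _, .id _⟩
  comp F G := ⟨F.1 ⋙ G.1, F.2.1.comp G.2.1, F.2.2.comp G.2.2⟩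

/-- Forgetting the strict choice of coproducts. -/
def toCBCat : StrictCBCat.{v, u} ⥤ CBCat.{v, u} where
  obj C := ⟨C.carrier⟩
  map F := ⟨F.1, F.2.1, F.2.2.preservesFiniteCoproducts⟩

/-- The forgetful functor to categories. -/
def forget : StrictCBCat.{v, u} ⥤ Cat.{v, u} := toCBCat ⋙ CBCat.forget

end StrictCBCat

/-! ## Tapes -/

/-- Typed terms over a category `C`. Types are arrows between words `P, Q : List C` of objects,
where a word is regarded as the formal sum of its letters. -/
inductive TapeTerm (C : Type u) [Category.{v} C] : List C → List C → Type (max u v)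
  | diag (p : OpenUnit) (U : C) : TapeTerm C [U] [U, U]
  | bang (U : C) : TapeTerm C [U] []
  | tape {U V : C} (c : U ⟶ V) : TapeTerm C [U] [V]
  | cobang (U : C) : TapeTerm C [] [U]
  | codiag (U : C) : TapeTerm C [U, U] [U]
  | idObj (U : C) : TapeTerm C [U] [U]
  | idZero : TapeTerm C [] []
  | sym (U V : C) : TapeTerm C [U, V] [V, U]
  | comp {P Q R : List C} (t : TapeTerm C P Q) (s : TapeTerm C Q R) : TapeTerm C P R
  | sum {P₁ Q₁ P₂ Q₂ : List C} (t : TapeTerm C P₁ Q₁) (s : TapeTerm C P₂ Q₂) :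
      TapeTerm C (P₁ ++ P₂) (Q₁ ++ Q₂)

namespace TapeTerm

variable {C : Type u} [Category.{v} C]

/-- Transport of a term along equalities of words (concatenation of words is only propositionally
associative and right unital in Lean). -/
def cast {P P' Q Q' : List C} (hP : P = P') (hQ : Q = Q') (t : TapeTerm C P Q) : TapeTerm C P' Q' :=
  hP ▸ hQ ▸ t

/-- `id_P` for a word `P`. -/
def idP : (P : List C) → TapeTerm C P P
  | [] => idZero
  | U :: P => (idObj U).sum (idP P)

/-- `bang_P : P → 0`. -/
def bangP : (P : List C) → TapeTerm C P []
  | [] => idZero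
  | U :: P => (bang U).sum (bangP P)

/-- `cobang_P : 0 → P`. -/
def cobangP : (P : List C) → TapeTerm C [] P
  | [] => idZero
  | U :: P => (cobang U).sum (cobangP P)

/-- The symmetry `U ⊕ Q → Q ⊕ U` for an object `U` and a word `Q`. -/
def symOne (U : C) : (Q : List C) → TapeTerm C (U :: Q) (Q ++ [U])
  | [] => idObj U
  | V :: Q => ((sym U V).sum (idP Q)).comp ((idObj V).sum (symOne U Q))

/-- The symmetry `P ⊕ Q → Q ⊕ P` for words `P` and `Q`. -/
def symP : (P Q : List C) → TapeTerm C (P ++ Q) (Q ++ P)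
  | [], Q => cast rfl (List.append_nil Q).symm (idP Q)
  | U :: P, Q => cast rfl (List.append_cons Q U P).symm
      (((idObj U).sum (symP P Q)).comp ((symOne U Q).sum (idP P)))

/-- `diag_P : P → P ⊕ P`. -/
def diagP (p : OpenUnit) : (P : List C) → TapeTerm C P (P ++ P)
  | [] => idZero
  | U :: P => ((diag p U).sum (diagP p P)).comp
      (cast rfl (congrArg (U :: ·) (List.append_cons P U P).symm)
        ((idObj U).sum ((symOne U P).sum (idP P))))

/-- `codiag_P : P ⊕ P → P`. -/
def codiagP : (P : List C) → TapeTerm C (P ++ P) P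
  | [] => idZero
  | U :: P => (cast (congrArg (U :: ·) (List.append_cons P U P).symm) rfl
        ((idObj U).sum ((symP P [U]).sum (idP P)))).comp
      ((codiag U).sum (codiagP P))

/-- The congruence on terms generated by the axioms of strict symmetric monoidal categories, of
natural and coherent monoids, of natural and coherent co-pcas, and functoriality of `tape`. The
axioms `cobang_0 = codiag_0 = diag_0 = bang_0 = id_0` hold by definition. -/
inductive Rel : {P Q : List C} → TapeTerm C P Q → TapeTerm C P Q → Prop
  -- congruence
  | refl {P Q : List C} (t : TapeTerm C P Q) : Rel t t
  | symm {P Q : List C} {t s : TapeTerm C P Q} : Rel t s → Rel s t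
  | trans {P Q : List C} {t s r : TapeTerm C P Q} : Rel t s → Rel s r → Rel t r
  | comp_congr {P Q R : List C} {t t' : TapeTerm C P Q} {s s' : TapeTerm C Q R} :
      Rel t t' → Rel s s' → Rel (t.comp s) (t'.comp s')
  | sum_congr {P₁ Q₁ P₂ Q₂ : List C} {t t' : TapeTerm C P₁ Q₁} {s s' : TapeTerm C P₂ Q₂} :
      Rel t t' → Rel s s' → Rel (t.sum s) (t'.sum s')
  -- strict symmetric monoidal categories
  | comp_assoc {P Q R S : List C} (f : TapeTerm C P Q) (g : TapeTerm C Q R) (h : TapeTerm C R S) :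
      Rel ((f.comp g).comp h) (f.comp (g.comp h))
  | id_comp {P Q : List C} (f : TapeTerm C P Q) : Rel ((idP P).comp f) f
  | comp_id {P Q : List C} (f : TapeTerm C P Q) : Rel (f.comp (idP Q)) f
  | interchange {P₁ Q₁ R₁ P₂ Q₂ R₂ : List C} (f₁ : TapeTerm C P₁ Q₁) (f₂ : TapeTerm C P₂ Q₂)
      (g₁ : TapeTerm C Q₁ R₁) (g₂ : TapeTerm C Q₂ R₂) :
      Rel ((f₁.sum f₂).comp (g₁.sum g₂)) ((f₁.comp g₁).sum (f₂.comp g₂))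
  | zero_sum {P Q : List C} (f : TapeTerm C P Q) : Rel (idZero.sum f) f
  | sum_zero {P Q : List C} (f : TapeTerm C P Q) :
      Rel (cast (List.append_nil P) (List.append_nil Q) (f.sum idZero)) f
  | sum_assoc {P₁ Q₁ P₂ Q₂ P₃ Q₃ : List C} (f : TapeTerm C P₁ Q₁) (g : TapeTerm C P₂ Q₂)
      (h : TapeTerm C P₃ Q₃) :
      Rel (cast (List.append_assoc P₁ P₂ P₃) (List.append_assoc Q₁ Q₂ Q₃) ((f.sum g).sum h))
        (f.sum (g.sum h))
  | sym_sym (P Q : List C) : Rel ((symP P Q).comp (symP Q P)) (idP (P ++ Q))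
  | sym_nat {P Q : List C} (s : TapeTerm C P Q) (R : List C) :
      Rel ((s.sum (idP R)).comp (symP Q R)) ((symP P R).comp ((idP R).sum s))
  -- natural and coherent monoids
  | codiag_assoc (P : List C) :
      Rel (((idP P).sum (codiagP P)).comp (codiagP P))
        (cast (List.append_assoc P P P) rfl (((codiagP P).sum (idP P)).comp (codiagP P)))
  | codiag_unit (P : List C) : Rel (((cobangP P).sum (idP P)).comp (codiagP P)) (idP P)
  | codiag_sym (P : List C) : Rel ((symP P P).comp (codiagP P)) (codiagP P)
  | cobang_coh (P Q : List C) : Rel (cobangP (P ++ Q)) ((cobangP P).sum (cobangP Q))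
  | codiag_coh (P Q : List C) :
      Rel (codiagP (P ++ Q))
        ((cast (by simp) (by simp) ((idP P).sum ((symP Q P).sum (idP Q))) :
            TapeTerm C ((P ++ Q) ++ (P ++ Q)) ((P ++ P) ++ (Q ++ Q))).comp
          ((codiagP P).sum (codiagP Q)))
  | cobang_nat {P Q : List C} (f : TapeTerm C P Q) : Rel ((cobangP P).comp f) (cobangP Q)
  | codiag_nat {P Q : List C} (f : TapeTerm C P Q) :
      Rel ((codiagP P).comp f) ((f.sum f).comp (codiagP Q))
  -- natural and coherent co-pcas
  | diag_assoc (p q : OpenUnit) (P : List C) :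
      Rel (cast rfl (List.append_assoc P P P) ((diagP p P).comp ((diagP q P).sum (idP P))))
        ((diagP (p.tildeP q) P).comp ((idP P).sum (diagP (p.tildeQ q) P)))
  | diag_idem (p : OpenUnit) (P : List C) : Rel ((diagP p P).comp (codiagP P)) (idP P)
  | diag_sym (p : OpenUnit) (P : List C) : Rel ((diagP p P).comp (symP P P)) (diagP p.compl P)
  | bang_coh (P Q : List C) : Rel (bangP (P ++ Q)) ((bangP P).sum (bangP Q))
  | diag_coh (p : OpenUnit) (P Q : List C) :
      Rel (diagP p (P ++ Q))
        (((diagP p P).sum (diagP p Q)).comp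
          (cast (by simp) (by simp) ((idP P).sum ((symP P Q).sum (idP Q))) :
            TapeTerm C ((P ++ P) ++ (Q ++ Q)) ((P ++ Q) ++ (P ++ Q))))
  | bang_nat {P Q : List C} (f : TapeTerm C P Q) : Rel (f.comp (bangP Q)) (bangP P)
  | diag_nat (p : OpenUnit) {P Q : List C} (f : TapeTerm C P Q) :
      Rel (f.comp (diagP p Q)) ((diagP p P).comp (f.sum f))
  -- functoriality of `tape`
  | tape_id (U : C) : Rel (tape (𝟙 U)) (idObj U)
  | tape_comp {U V W : C} (c : U ⟶ V) (d : V ⟶ W) :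
      Rel (tape (c ≫ d)) ((tape c).comp (tape d))

/-- Equality of terms modulo the axioms. -/
instance setoid (P Q : List C) : Setoid (TapeTerm C P Q) :=
  ⟨Rel, Rel.refl, Rel.symm, Rel.trans⟩

end TapeTerm

/-- The objects of the category `T(C)` of tapes over `C`: words of objects of `C`. -/
abbrev Tape (C : Type u) : Type u := List C

namespace Tape

open TapeTerm

variable {C : Type u} [Category.{v} C]

/-- Arrows of `T(C)`: terms modulo the axioms. -/
def Hom (P Q : Tape C) : Type (max u v) := Quotient (TapeTerm.setoid (C := C) P Q)

instance : Category.{max u v} (Tape C) where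
  Hom := Hom
  id P := Quotient.mk _ (idP P)
  comp := Quotient.map₂ TapeTerm.comp fun _ _ h _ _ h' => Rel.comp_congr h h'
  id_comp := by rintro P Q ⟨f⟩; exact Quotient.sound (Rel.id_comp f)
  comp_id := by rintro P Q ⟨f⟩; exact Quotient.sound (Rel.comp_id f)
  assoc := by rintro P Q R S ⟨f⟩ ⟨g⟩ ⟨h⟩; exact Quotient.sound (Rel.comp_assoc f g h)

/-- The arrow of `T(C)` represented by a term. -/
def mk {P Q : Tape C} (t : TapeTerm C P Q) : P ⟶ Q := Quotient.mk (TapeTerm.setoid P Q) t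

/-- The sum of two arrows. -/
def tensor {P₁ Q₁ P₂ Q₂ : Tape C} : (P₁ ⟶ Q₁) → (P₂ ⟶ Q₂) → (P₁ ++ P₂ ⟶ Q₁ ++ Q₂) :=
  Quotient.map₂ TapeTerm.sum fun _ _ h _ _ h' => Rel.sum_congr h h'

/-- The arrow `diag_P`. -/
def diag (p : OpenUnit) (P : Tape C) : P ⟶ P ++ P := mk (diagP p P)

/-- The arrow `codiag_P`. -/
def codiag (P : Tape C) : P ++ P ⟶ P := mk (codiagP P)

/-- The arrow `bang_P`. -/
def bang (P : Tape C) : P ⟶ [] := mk (bangP P)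

/-- The arrow `cobang_P`. -/
def cobang (P : Tape C) : [] ⟶ P := mk (cobangP P)

/-- The symmetry. -/
def symm (P Q : Tape C) : P ++ Q ⟶ Q ++ P := mk (symP P Q)

theorem mk_surj {P Q : Tape C} (f : P ⟶ Q) : ∃ t, mk t = f := Quotient.exists_rep f

theorem mk_eq {P Q : Tape C} {t s : TapeTerm C P Q} (h : Rel t s) : mk t = mk s :=
  Quotient.sound h

theorem mk_comp {P Q R : Tape C} (t : TapeTerm C P Q) (s : TapeTerm C Q R) :
    mk (t.comp s) = mk t ≫ mk s := rfl

theorem mk_sum {P₁ Q₁ P₂ Q₂ : Tape C} (t : TapeTerm C P₁ Q₁) (s : TapeTerm C P₂ Q₂) :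
    mk (t.sum s) = tensor (mk t) (mk s) := rfl

theorem mk_idP (P : Tape C) : mk (idP P) = 𝟙 P := rfl

theorem mk_cast {P P' Q Q' : Tape C} (hP : P = P') (hQ : Q = Q') (t : TapeTerm C P Q) :
    mk (cast hP hQ t) = eqToHom hP.symm ≫ mk t ≫ eqToHom hQ := by
  subst hP hQ; simp [TapeTerm.cast]

theorem tensor_comp {P₁ Q₁ R₁ P₂ Q₂ R₂ : Tape C} (f₁ : P₁ ⟶ Q₁) (g₁ : Q₁ ⟶ R₁)
    (f₂ : P₂ ⟶ Q₂) (g₂ : Q₂ ⟶ R₂) :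
    tensor (f₁ ≫ g₁) (f₂ ≫ g₂) = tensor f₁ f₂ ≫ tensor g₁ g₂ := by
  obtain ⟨f₁, rfl⟩ := mk_surj f₁
  obtain ⟨f₂, rfl⟩ := mk_surj f₂
  obtain ⟨g₁, rfl⟩ := mk_surj g₁
  obtain ⟨g₂, rfl⟩ := mk_surj g₂
  exact (mk_eq (Rel.interchange f₁ f₂ g₁ g₂)).symm

theorem tensor_assoc {P₁ Q₁ P₂ Q₂ P₃ Q₃ : Tape C} (f : P₁ ⟶ Q₁) (g : P₂ ⟶ Q₂)
    (h : P₃ ⟶ Q₃) :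
    tensor (tensor f g) h = eqToHom (List.append_assoc _ _ _) ≫ tensor f (tensor g h) ≫
      eqToHom (List.append_assoc _ _ _).symm := by
  obtain ⟨f, rfl⟩ := mk_surj f
  obtain ⟨g, rfl⟩ := mk_surj g
  obtain ⟨h, rfl⟩ := mk_surj h
  simp only [← mk_sum]
  rw [← mk_eq (Rel.sum_assoc f g h), mk_cast]
  simp

theorem tensor_zero {P Q : Tape C} (f : P ⟶ Q) :
    tensor f (𝟙 []) = eqToHom (List.append_nil _) ≫ f ≫ eqToHom (List.append_nil _).symm := by
  obtain ⟨f, rfl⟩ := mk_surj f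
  have := mk_eq (Rel.sum_zero f)
  rw [mk_cast] at this
  change _ ≫ tensor (mk f) (𝟙 []) ≫ _ = _ at this
  conv_rhs => rw [← this]
  simp

theorem zero_tensor {P Q : Tape C} (f : P ⟶ Q) : tensor (𝟙 []) f = f := by
  obtain ⟨f, rfl⟩ := mk_surj f
  exact mk_eq (Rel.zero_sum f)

theorem tensor_id (P Q : Tape C) : tensor (𝟙 P) (𝟙 Q) = 𝟙 (P ++ Q) := by
  induction P with
  | nil => exact zero_tensor _
  | cons U P ih =>
    have h (P : Tape C) : 𝟙 (U :: P) = tensor (mk (idObj U)) (𝟙 P) := rfl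
    rw [h, tensor_assoc, ih]
    simp; rfl

theorem tensor_eqToHom {P P' Q Q' : Tape C} (h : P = P') (h' : Q = Q') :
    tensor (eqToHom h) (eqToHom h') = eqToHom (by rw [h, h']) := by
  subst h h'; simp [tensor_id]

theorem tensor_eqToHom_right (P : Tape C) {Q Q' : Tape C} (h : Q = Q') :
    tensor (𝟙 P) (eqToHom h) = eqToHom (congrArg (P ++ ·) h) :=
  tensor_eqToHom (rfl : P = P) h

theorem tensor_eqToHom_left {P P' : Tape C} (h : P = P') (Q : Tape C) :
    tensor (eqToHom h) (𝟙 Q) = eqToHom (congrArg (· ++ Q) h) :=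
  tensor_eqToHom h (rfl : Q = Q)

theorem tensor_middle {P₁ Q₁ P₂ Q₂ P₃ Q₃ P₄ Q₄ : Tape C} (a : P₁ ⟶ Q₁) (b : P₂ ⟶ Q₂)
    (c : P₃ ⟶ Q₃) (d : P₄ ⟶ Q₄) :
    tensor (tensor a b) (tensor c d) =
      eqToHom (by simp) ≫ tensor a (tensor (tensor b c) d) ≫ eqToHom (by simp) := by
  have h : tensor a (tensor (tensor b c) d) =
      eqToHom (by simp) ≫ tensor a (tensor b (tensor c d)) ≫ eqToHom (by simp) := by
    have := tensor_comp (𝟙 P₁) (a ≫ 𝟙 Q₁) (eqToHom (List.append_assoc P₂ P₃ P₄))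
      (tensor b (tensor c d) ≫ eqToHom (List.append_assoc Q₂ Q₃ Q₄).symm)
    rw [← tensor_assoc, tensor_comp a, tensor_eqToHom_right, tensor_eqToHom_right] at this
    simpa using this
  rw [h, tensor_assoc]; simp

theorem symm_nat_left {P Q : Tape C} (f : P ⟶ Q) (R : Tape C) :
    tensor f (𝟙 R) ≫ symm Q R = symm P R ≫ tensor (𝟙 R) f := by
  obtain ⟨f, rfl⟩ := mk_surj f
  exact mk_eq (Rel.sym_nat f R)

theorem symm_symm (P Q : Tape C) : symm P Q ≫ symm Q P = 𝟙 _ := mk_eq (Rel.sym_sym P Q)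

theorem symm_nat {P P' Q Q' : Tape C} (f : P ⟶ P') (g : Q ⟶ Q') :
    tensor f g ≫ symm P' Q' = symm P Q ≫ tensor g f := by
  have h : tensor (𝟙 P') g ≫ symm P' Q' = symm P' Q ≫ tensor g (𝟙 P') := by
    have := congrArg (fun k => symm P' Q ≫ k ≫ symm P' Q') (symm_nat_left g P')
    simp only [Category.assoc] at this
    rw [symm_symm, ← Category.assoc (symm P' Q) (symm Q P'), symm_symm] at this
    simpa using this.symm
  calc tensor f g ≫ symm P' Q' = tensor f (𝟙 _) ≫ tensor (𝟙 _) g ≫ symm P' Q' := by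
        rw [← Category.assoc, ← tensor_comp]; simp
    _ = symm P Q ≫ tensor g f := by
        rw [h, ← Category.assoc, symm_nat_left, Category.assoc, ← tensor_comp]; simp

theorem codiag_assoc (P : Tape C) :
    tensor (codiag P) (𝟙 P) ≫ codiag P =
      eqToHom (List.append_assoc P P P) ≫ tensor (𝟙 P) (codiag P) ≫ codiag P := by
  have := mk_eq (Rel.codiag_assoc P)
  rw [mk_cast] at this
  simp only [mk_comp, mk_sum, mk_idP] at this
  change tensor (𝟙 P) (codiag P) ≫ codiag P =
    _ ≫ (tensor (codiag P) (𝟙 P) ≫ codiag P) ≫ _ at this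
  rw [this]; simp

theorem codiag_unit (P : Tape C) : tensor (cobang P) (𝟙 P) ≫ codiag P = 𝟙 P :=
  mk_eq (Rel.codiag_unit P)

theorem codiag_symm (P : Tape C) : symm P P ≫ codiag P = codiag P := mk_eq (Rel.codiag_sym P)

theorem codiag_nat {P Q : Tape C} (f : P ⟶ Q) : codiag P ≫ f = tensor f f ≫ codiag Q := by
  obtain ⟨f, rfl⟩ := mk_surj f
  exact mk_eq (Rel.codiag_nat f)

theorem cobang_nat {P Q : Tape C} (f : P ⟶ Q) : cobang P ≫ f = cobang Q := by
  obtain ⟨f, rfl⟩ := mk_surj f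
  exact mk_eq (Rel.cobang_nat f)

theorem bang_nat {P Q : Tape C} (f : P ⟶ Q) : f ≫ bang Q = bang P := by
  obtain ⟨f, rfl⟩ := mk_surj f
  exact mk_eq (Rel.bang_nat f)

theorem diag_nat (p : OpenUnit) {P Q : Tape C} (f : P ⟶ Q) :
    f ≫ diag p Q = diag p P ≫ tensor f f := by
  obtain ⟨f, rfl⟩ := mk_surj f
  exact mk_eq (Rel.diag_nat p f)

theorem diag_assoc (p q : OpenUnit) (P : Tape C) :
    diag p P ≫ tensor (diag q P) (𝟙 P) =
      diag (p.tildeP q) P ≫ tensor (𝟙 P) (diag (p.tildeQ q) P) ≫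
        eqToHom (List.append_assoc P P P).symm := by
  have := mk_eq (Rel.diag_assoc p q P)
  rw [mk_cast] at this
  simp only [mk_comp, mk_sum, mk_idP] at this
  change _ ≫ (diag p P ≫ tensor (diag q P) (𝟙 P)) ≫ _ =
    diag (p.tildeP q) P ≫ tensor (𝟙 P) (diag (p.tildeQ q) P) at this
  rw [← Category.assoc (diag (p.tildeP q) P), ← this]; simp

theorem diag_idem (p : OpenUnit) (P : Tape C) : diag p P ≫ codiag P = 𝟙 P :=
  mk_eq (Rel.diag_idem p P)

theorem diag_symm (p : OpenUnit) (P : Tape C) : diag p P ≫ symm P P = diag p.compl P :=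
  mk_eq (Rel.diag_sym p P)

/-- The convex algebra on `T(C)[P, Q]`: `f +_p g = diag_p ; (f ⊕ g) ; codiag` and
`star = bang ; cobang`. -/
instance pca (P Q : Tape C) : PCA (P ⟶ Q) where
  star := bang P ≫ cobang Q
  conv p f g := diag p P ≫ tensor f g ≫ codiag Q
  conv_assoc p q f g h := by
    have e1 : tensor (diag q P ≫ tensor f g ≫ codiag Q) h =
        tensor (diag q P) (𝟙 P) ≫ tensor (tensor f g) h ≫ tensor (codiag Q) (𝟙 Q) := by
      rw [← tensor_comp, ← tensor_comp]; simp
    have e2 (r : OpenUnit) : tensor f (diag r P ≫ tensor g h ≫ codiag Q) =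
        tensor (𝟙 P) (diag r P) ≫ tensor f (tensor g h) ≫ tensor (𝟙 Q) (codiag Q) := by
      rw [← tensor_comp, ← tensor_comp]; simp
    rw [e1, e2]
    simp only [Category.assoc]
    rw [codiag_assoc, tensor_assoc, ← Category.assoc, diag_assoc]
    simp
  conv_comm p f g := by
    rw [← diag_symm, Category.assoc, ← Category.assoc (symm P P), ← symm_nat, Category.assoc,
      codiag_symm]
  conv_idem p f := by rw [← codiag_nat, ← Category.assoc, diag_idem, Category.id_comp]

/-- `T(C)` is `PCA`-enriched. -/
instance pcaEnriched : PCAEnriched (Tape C) where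
  pca := pca
  comp_conv p e f g := by
    change e ≫ diag _ _ ≫ _ ≫ _ = diag _ _ ≫ _ ≫ _
    rw [← Category.assoc, diag_nat, tensor_comp]; simp
  conv_comp p f g h := by
    change (diag _ _ ≫ _ ≫ _) ≫ _ = diag _ _ ≫ _ ≫ _
    simp only [Category.assoc]
    rw [codiag_nat, tensor_comp]; simp
  comp_star f := by
    change f ≫ bang _ ≫ cobang _ = _
    rw [← Category.assoc, bang_nat]; rfl
  star_comp f := by
    change (bang _ ≫ cobang _) ≫ f = _
    rw [Category.assoc, cobang_nat]; rfl

/-! ### Coproducts in `T(C)` -/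

/-- The first injection `id_P ⊕ cobang_Q`. -/
def inl (P Q : Tape C) : P ⟶ P ++ Q :=
  eqToHom (List.append_nil P).symm ≫ tensor (𝟙 P) (cobang Q)

/-- The second injection `cobang_P ⊕ id_Q`. -/
def inr (P Q : Tape C) : Q ⟶ P ++ Q := tensor (cobang P) (𝟙 Q)

theorem cobang_nil : cobang ([] : Tape C) = 𝟙 [] := rfl

theorem cobang_append (P Q : Tape C) : cobang (P ++ Q) = tensor (cobang P) (cobang Q) :=
  mk_eq (Rel.cobang_coh P Q)

theorem symm_nil (P : Tape C) : symm P [] = eqToHom (List.append_nil P) := by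
  induction P with
  | nil => rfl
  | cons U P ih =>
    change mk (cast _ _ _) = _
    rw [mk_cast, mk_comp, mk_sum, mk_sum]
    have h1 : mk (symP P []) = eqToHom (List.append_nil P) := ih
    have h2 : mk (symOne U []) = 𝟙 [U] := (mk_eq (Rel.sum_zero (idObj U))).symm
    have h3 : mk (idObj U) = 𝟙 [U] := h2
    rw [h1, h2, h3, mk_idP, tensor_id, tensor_eqToHom_right]
    simp

theorem codiag_unit_right (P : Tape C) :
    tensor (𝟙 P) (cobang P) ≫ codiag P = eqToHom (List.append_nil P) := by
  rw [← codiag_symm, ← Category.assoc, symm_nat, Category.assoc, codiag_unit, symm_nil]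
  simp

theorem inl_tensor {P Q R S : Tape C} (f : P ⟶ R) (g : Q ⟶ S) :
    inl P Q ≫ tensor f g = f ≫ inl R S := by
  rw [inl, inl, Category.assoc, ← tensor_comp, cobang_nat]
  have : tensor (𝟙 P ≫ f) (cobang S) = tensor f (𝟙 []) ≫ tensor (𝟙 R) (cobang S) := by
    rw [← tensor_comp]; simp
  rw [this, tensor_zero]; simp

theorem inr_tensor {P Q R S : Tape C} (f : P ⟶ R) (g : Q ⟶ S) :
    inr P Q ≫ tensor f g = g ≫ inr R S := by
  rw [inr, inr, ← tensor_comp, cobang_nat]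
  have : tensor (cobang R) (𝟙 Q ≫ g) = tensor (𝟙 []) g ≫ tensor (cobang R) (𝟙 S) := by
    rw [← tensor_comp]; simp
  rw [this, zero_tensor]

theorem inl_codiag (P : Tape C) : inl P P ≫ codiag P = 𝟙 P := by
  rw [inl, Category.assoc, codiag_unit_right]; simp

theorem inr_codiag (P : Tape C) : inr P P ≫ codiag P = 𝟙 P := codiag_unit P

theorem codiag_append (P Q : Tape C) :
    codiag (P ++ Q) = eqToHom (by simp) ≫ tensor (𝟙 P) (tensor (symm Q P) (𝟙 Q)) ≫
      eqToHom (by simp) ≫ tensor (codiag P) (codiag Q) := by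
  have := mk_eq (Rel.codiag_coh P Q)
  rw [mk_comp, mk_cast] at this
  simp only [Category.assoc] at this
  exact this

theorem copair_injections (P Q : Tape C) :
    tensor (inl P Q) (inr P Q) ≫ codiag (P ++ Q) = 𝟙 _ := by
  have h₁ : tensor (inl P Q) (inr P Q) = eqToHom (by simp) ≫
      tensor (tensor (𝟙 P) (cobang Q)) (tensor (cobang P) (𝟙 Q)) := by
    have := tensor_comp (eqToHom (List.append_nil P).symm) (tensor (𝟙 P) (cobang Q))
      (𝟙 Q) (tensor (cobang P) (𝟙 Q))
    rw [tensor_eqToHom_left, Category.id_comp] at this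
    exact this
  have h₂ : tensor (tensor (cobang Q) (cobang P)) (𝟙 Q) ≫ tensor (symm Q P) (𝟙 Q) =
      tensor (tensor (cobang P) (cobang Q)) (𝟙 Q) := by
    rw [← tensor_comp, ← cobang_append, ← cobang_append]
    congr 1
    · exact cobang_nat _
    · simp
  have h₃ : tensor (𝟙 P) (tensor (tensor (cobang Q) (cobang P)) (𝟙 Q)) ≫
      tensor (𝟙 P) (tensor (symm Q P) (𝟙 Q)) =
      tensor (𝟙 P) (tensor (tensor (cobang P) (cobang Q)) (𝟙 Q)) := by
    rw [← tensor_comp, h₂]; simp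
  have h₄ : tensor (tensor (𝟙 P) (cobang P)) (tensor (cobang Q) (𝟙 Q)) ≫
      tensor (codiag P) (codiag Q) = eqToHom (by simp) := by
    rw [← tensor_comp, codiag_unit_right, codiag_unit]
    exact tensor_eqToHom_left _ _
  rw [tensor_middle] at h₄
  rw [h₁, codiag_append, tensor_middle]
  simp only [Category.assoc, eqToHom_trans_assoc, eqToHom_refl, Category.id_comp] at h₄ ⊢
  rw [reassoc_of% h₃]
  exact ((eqToHom_comp_iff _ _ _).1 h₄).trans (by simp)

theorem inl_comp_inl (P Q R : Tape C) :
    inl P Q ≫ inl (P ++ Q) R ≫ eqToHom (List.append_assoc P Q R) = inl P (Q ++ R) := by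
  have h : inl P Q ≫ inl (P ++ Q) R = inl P [] ≫ tensor (inl P Q) (cobang R) :=
    (inl_tensor (inl P Q) (cobang R)).symm
  have h' : tensor (inl P Q) (cobang R) = eqToHom (by simp) ≫
      tensor (tensor (𝟙 P) (cobang Q)) (cobang R) := by
    have := tensor_comp (eqToHom (List.append_nil P).symm) (tensor (𝟙 P) (cobang Q))
      (𝟙 []) (cobang R)
    rw [tensor_eqToHom_left, Category.id_comp] at this
    exact this
  rw [reassoc_of% h, h', tensor_assoc, ← cobang_append, inl, inl, cobang_nil, tensor_id]
  simp

theorem inr_comp_inl (P Q R : Tape C) :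
    inr P Q ≫ inl (P ++ Q) R ≫ eqToHom (List.append_assoc P Q R) =
      inl Q R ≫ inr P (Q ++ R) := by
  have h : inr P Q ≫ inl (P ++ Q) R = inl Q [] ≫ tensor (inr P Q) (cobang R) :=
    (inl_tensor (inr P Q) (cobang R)).symm
  have h' : inl Q R ≫ inr P (Q ++ R) = inr [] Q ≫ tensor (cobang P) (inl Q R) :=
    (inr_tensor (cobang P) (inl Q R)).symm
  have h'' : tensor (cobang P) (inl Q R) = eqToHom (by simp) ≫
      tensor (cobang P) (tensor (𝟙 Q) (cobang R)) := by
    have := tensor_comp (𝟙 []) (cobang P) (eqToHom (List.append_nil Q).symm)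
      (tensor (𝟙 Q) (cobang R))
    rw [tensor_eqToHom_right, Category.id_comp] at this
    exact this
  rw [reassoc_of% h, h', h'', inr, inr, tensor_assoc, inl, cobang_nil, tensor_id, tensor_id]
  simp

theorem inr_comp_inr (P Q R : Tape C) :
    inr (P ++ Q) R ≫ eqToHom (List.append_assoc P Q R) = inr Q R ≫ inr P (Q ++ R) := by
  have h : inr Q R ≫ inr P (Q ++ R) = inr [] R ≫ tensor (cobang P) (inr Q R) :=
    (inr_tensor (cobang P) (inr Q R)).symm
  rw [h, inr, cobang_append, tensor_assoc, inr, inr, cobang_nil, tensor_id]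
  simp

theorem sum_coproduct (P Q : Tape C) :
    Nonempty (IsColimit (BinaryCofan.mk (inl P Q) (inr P Q))) := by
  have h₁ {R : Tape C} (f : P ⟶ R) (g : Q ⟶ R) : inl P Q ≫ tensor f g ≫ codiag R = f := by
    rw [← Category.assoc, inl_tensor, Category.assoc, inl_codiag, Category.comp_id]
  have h₂ {R : Tape C} (f : P ⟶ R) (g : Q ⟶ R) : inr P Q ≫ tensor f g ≫ codiag R = g := by
    rw [← Category.assoc, inr_tensor, Category.assoc, inr_codiag, Category.comp_id]
  have h₃ {R : Tape C} (m : P ++ Q ⟶ R) :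
      m = tensor (inl P Q ≫ m) (inr P Q ≫ m) ≫ codiag R := by
    rw [tensor_comp, Category.assoc, ← codiag_nat, ← Category.assoc,
        copair_injections, Category.id_comp]
  exact ⟨BinaryCofan.isColimitMk (fun s => tensor s.inl s.inr ≫ codiag s.pt)
    (fun s => h₁ s.inl s.inr) (fun s => h₂ s.inl s.inr)
    (fun s m e₁ e₂ => by rw [← e₁, ← e₂]; exact h₃ m)⟩

/-- Concatenation of words is a strict choice of coproducts in `T(C)`. -/
instance strictSums : StrictSums (Tape C) where
  zero := []
  sum P Q := P ++ Q
  inl := inl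
  inr := inr
  zero_initial := ⟨IsInitial.ofUniqueHom cobang fun P f => by
    rw [← cobang_nat f, cobang_nil, Category.id_comp]⟩
  sum_coproduct := sum_coproduct
  zero_sum _ := rfl
  sum_zero := List.append_nil
  sum_assoc := List.append_assoc
  inr_zero P := tensor_id [] P
  inl_zero P := by rw [inl, cobang_nil, tensor_id]; simp
  inl_inl := inl_comp_inl
  inr_inl := inr_comp_inl
  inr_inr := inr_comp_inr

end Tape

/-! ### Functoriality of `T(C)` in `C` -/

namespace TapeTerm

variable {C : Type u} [Category.{v} C] {D : Type u'} [Category.{w} D]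

/-- Applying a functor to all letters of a term. -/
def map (F : C ⥤ D) : {P Q : List C} → TapeTerm C P Q →
    TapeTerm D (P.map F.obj) (Q.map F.obj)
  | _, _, diag p U => diag p (F.obj U)
  | _, _, bang U => bang (F.obj U)
  | _, _, tape c => tape (F.map c)
  | _, _, cobang U => cobang (F.obj U)
  | _, _, codiag U => codiag (F.obj U)
  | _, _, idObj U => idObj (F.obj U)
  | _, _, idZero => idZero
  | _, _, sym U V => sym (F.obj U) (F.obj V)
  | _, _, comp t s => (map F t).comp (map F s)
  | _, _, sum t s => cast List.map_append.symm List.map_append.symm ((map F t).sum (map F s))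

/-- Equality modulo the axioms for terms whose types are only propositionally equal. -/
def HRel {P Q P' Q' : List C} (t : TapeTerm C P Q) (s : TapeTerm C P' Q') : Prop :=
  ∃ (hP : P = P') (hQ : Q = Q'), Rel (cast hP hQ t) s

theorem HRel.of {P Q : List C} {t s : TapeTerm C P Q} (h : Rel t s) : HRel t s := ⟨rfl, rfl, h⟩

theorem HRel.same {P Q : List C} {t : TapeTerm C P Q} : HRel t t := .of (.refl t)

theorem HRel.rel {P Q : List C} {t s : TapeTerm C P Q} (h : HRel t s) : Rel t s := by
  obtain ⟨_, _, h⟩ := h; exact h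

theorem HRel.symm {P Q P' Q' : List C} {t : TapeTerm C P Q} {s : TapeTerm C P' Q'}
    (h : HRel t s) : HRel s t := by
  obtain ⟨rfl, rfl, h⟩ := h; exact .of (.symm h)

theorem HRel.trans {P Q P' Q' P'' Q'' : List C} {t : TapeTerm C P Q} {s : TapeTerm C P' Q'}
    {r : TapeTerm C P'' Q''} (h : HRel t s) (h' : HRel s r) : HRel t r := by
  obtain ⟨rfl, rfl, h⟩ := h
  obtain ⟨rfl, rfl, h'⟩ := h'
  exact .of (.trans h h')

theorem HRel.cast_self {P Q P' Q' : List C} (hP : P = P') (hQ : Q = Q') (t : TapeTerm C P Q) :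
    HRel (cast hP hQ t) t := by
  subst hP hQ; exact .same

theorem HRel.comp {P Q R P' Q' R' : List C} {t : TapeTerm C P Q} {s : TapeTerm C Q R}
    {t' : TapeTerm C P' Q'} {s' : TapeTerm C Q' R'} (h : HRel t t') (h' : HRel s s') :
    HRel (t.comp s) (t'.comp s') := by
  obtain ⟨rfl, rfl, h⟩ := h
  obtain ⟨_, rfl, h'⟩ := h'
  exact .of (.comp_congr h h')

theorem HRel.sum {P₁ Q₁ P₂ Q₂ P₁' Q₁' P₂' Q₂' : List C} {t : TapeTerm C P₁ Q₁}
    {s : TapeTerm C P₂ Q₂} {t' : TapeTerm C P₁' Q₁'} {s' : TapeTerm C P₂' Q₂'}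
    (h : HRel t t') (h' : HRel s s') : HRel (t.sum s) (t'.sum s') := by
  obtain ⟨rfl, rfl, h⟩ := h
  obtain ⟨rfl, rfl, h'⟩ := h'
  exact .of (.sum_congr h h')

theorem map_cast (F : C ⥤ D) {P Q P' Q' : List C} (hP : P = P') (hQ : Q = Q')
    (t : TapeTerm C P Q) : HRel (map F (cast hP hQ t)) (map F t) := by
  subst hP hQ; exact .same

theorem map_sum (F : C ⥤ D) {P₁ Q₁ P₂ Q₂ : List C} (t : TapeTerm C P₁ Q₁)
    (s : TapeTerm C P₂ Q₂) : HRel (map F (t.sum s)) ((map F t).sum (map F s)) :=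
  .cast_self _ _ _

theorem map_idP (F : C ⥤ D) (P : List C) : HRel (map F (idP P)) (idP (P.map F.obj)) := by
  induction P with
  | nil => exact .same
  | cons U P ih => exact (map_sum F (idObj U) (idP P)).trans (.sum .same ih)

theorem map_bangP (F : C ⥤ D) (P : List C) : HRel (map F (bangP P)) (bangP (P.map F.obj)) := by
  induction P with
  | nil => exact .same
  | cons U P ih => exact (map_sum F (bang U) (bangP P)).trans (.sum .same ih)

theorem map_cobangP (F : C ⥤ D) (P : List C) :
    HRel (map F (cobangP P)) (cobangP (P.map F.obj)) := by
  induction P with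
  | nil => exact .same
  | cons U P ih => exact (map_sum F (cobang U) (cobangP P)).trans (.sum .same ih)

theorem map_symOne (F : C ⥤ D) (U : C) (P : List C) :
    HRel (map F (symOne U P)) (symOne (F.obj U) (P.map F.obj)) := by
  induction P with
  | nil => exact .same
  | cons V P ih =>
    exact .comp ((map_sum F (sym U V) (idP P)).trans (.sum .same (map_idP F P)))
      ((map_sum F (idObj V) (symOne U P)).trans (.sum .same ih))

theorem map_symP (F : C ⥤ D) (P Q : List C) :
    HRel (map F (symP P Q)) (symP (P.map F.obj) (Q.map F.obj)) := by
  induction P with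
  | nil => exact (map_cast F _ _ _).trans ((map_idP F Q).trans (HRel.cast_self _ _ _).symm)
  | cons U P ih =>
    refine (map_cast F _ _ _).trans (HRel.trans ?_ (HRel.cast_self _ _ _).symm)
    exact .comp ((map_sum F (idObj U) (symP P Q)).trans (.sum .same ih))
      ((map_sum F (symOne U Q) (idP P)).trans (.sum (map_symOne F U Q) (map_idP F P)))

theorem map_diagP (F : C ⥤ D) (p : OpenUnit) (P : List C) :
    HRel (map F (diagP p P)) (diagP p (P.map F.obj)) := by
  induction P with
  | nil => exact .same
  | cons U P ih =>
    refine .comp ((map_sum F (diag p U) (diagP p P)).trans (.sum .same ih)) ?_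
    refine (map_cast F _ _ _).trans (HRel.trans ?_ (HRel.cast_self _ _ _).symm)
    exact (map_sum F (idObj U) _).trans (.sum .same
      ((map_sum F (symOne U P) (idP P)).trans (.sum (map_symOne F U P) (map_idP F P))))

theorem map_codiagP (F : C ⥤ D) (P : List C) :
    HRel (map F (codiagP P)) (codiagP (P.map F.obj)) := by
  induction P with
  | nil => exact .same
  | cons U P ih =>
    refine .comp ?_ ((map_sum F (codiag U) (codiagP P)).trans (.sum .same ih))
    refine (map_cast F _ _ _).trans (HRel.trans ?_ (HRel.cast_self _ _ _).symm)
    exact (map_sum F (idObj U) _).trans (.sum .same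
      ((map_sum F (symP P [U]) (idP P)).trans (.sum (map_symP F P [U]) (map_idP F P))))

theorem idP_congr {P P' : List C} (h : P = P') : HRel (idP P) (idP P') := by subst h; exact .same

theorem bangP_congr {P P' : List C} (h : P = P') : HRel (bangP P) (bangP P') := by
  subst h; exact .same

theorem cobangP_congr {P P' : List C} (h : P = P') : HRel (cobangP P) (cobangP P') := by
  subst h; exact .same

theorem diagP_congr (p : OpenUnit) {P P' : List C} (h : P = P') :
    HRel (diagP p P) (diagP p P') := by
  subst h; exact .same

theorem codiagP_congr {P P' : List C} (h : P = P') : HRel (codiagP P) (codiagP P') := by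
  subst h; exact .same

theorem Rel.map (F : C ⥤ D) {P Q : List C} {t s : TapeTerm C P Q} (h : Rel t s) :
    Rel (t.map F) (s.map F) := by
  induction h with
  | refl t => exact .refl _
  | symm _ ih => exact .symm ih
  | trans _ _ ih ih' => exact .trans ih ih'
  | comp_congr _ _ ih ih' => exact .comp_congr ih ih'
  | sum_congr _ _ ih ih' =>
    exact ((map_sum F _ _).trans ((HRel.sum (.of ih) (.of ih')).trans (map_sum F _ _).symm)).rel
  | comp_assoc f g h => exact .comp_assoc _ _ _
  | id_comp f => exact ((HRel.comp (map_idP F _) .same).trans (.of (.id_comp _))).rel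
  | comp_id f => exact ((HRel.comp .same (map_idP F _)).trans (.of (.comp_id _))).rel
  | interchange f₁ f₂ g₁ g₂ =>
    exact ((HRel.comp (map_sum F _ _) (map_sum F _ _)).trans ((HRel.of (.interchange _ _ _ _)).trans
      (map_sum F (f₁.comp g₁) (f₂.comp g₂)).symm)).rel
  | zero_sum f => exact ((map_sum F idZero f).trans (.of (.zero_sum (f.map F)))).rel
  | sum_zero f =>
    exact ((map_cast F _ _ _).trans ((map_sum F _ _).trans ((HRel.cast_self _ _ _).symm.trans
      (.of (.sum_zero _))))).rel
  | sum_assoc f g h =>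
    exact ((map_cast F _ _ _).trans ((map_sum F _ _).trans ((HRel.sum (map_sum F _ _) .same).trans
      ((HRel.cast_self _ _ _).symm.trans ((HRel.of (.sum_assoc _ _ _)).trans
        ((map_sum F _ _).trans (.sum .same (map_sum F _ _))).symm))))).rel
  | sym_sym P Q =>
    exact ((HRel.comp (map_symP F P Q) (map_symP F Q P)).trans ((HRel.of (.sym_sym _ _)).trans
      ((map_idP F _).trans (idP_congr List.map_append)).symm)).rel
  | sym_nat f R =>
    exact ((HRel.comp ((map_sum F _ _).trans (.sum .same (map_idP F R))) (map_symP F _ _)).trans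
      ((HRel.of (.sym_nat _ _)).trans (HRel.comp (map_symP F _ _)
        ((map_sum F _ _).trans (.sum (map_idP F R) .same))).symm)).rel
  | codiag_assoc P =>
    have h1 := map_codiagP F P
    have h2 := map_idP F P
    exact ((HRel.comp ((map_sum F _ _).trans (.sum h2 h1)) h1).trans
      ((HRel.of (.codiag_assoc _)).trans ((HRel.cast_self _ _ _).trans
        ((map_cast F _ _ (((codiagP P).sum (idP P)).comp (codiagP P))).trans
          (HRel.comp ((map_sum F _ _).trans (.sum h1 h2)) h1)).symm))).rel
  | codiag_unit P =>
    exact ((HRel.comp ((map_sum F _ _).trans (.sum (map_cobangP F P) (map_idP F P)))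
      (map_codiagP F P)).trans ((HRel.of (.codiag_unit _)).trans (map_idP F P).symm)).rel
  | codiag_sym P =>
    exact ((HRel.comp (map_symP F P P) (map_codiagP F P)).trans ((HRel.of (.codiag_sym _)).trans
      (map_codiagP F P).symm)).rel
  | cobang_coh P Q =>
    exact ((map_cobangP F _).trans ((cobangP_congr List.map_append).trans
      ((HRel.of (.cobang_coh _ _)).trans
        ((map_sum F _ _).trans (.sum (map_cobangP F P) (map_cobangP F Q))).symm))).rel
  | codiag_coh P Q =>
    refine ((map_codiagP F _).trans ((codiagP_congr List.map_append).trans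
      ((HRel.of (.codiag_coh _ _)).trans (HRel.symm (.comp ?_
        ((map_sum F _ _).trans (.sum (map_codiagP F P) (map_codiagP F Q)))))))).rel
    exact (map_cast F _ _ _).trans (((map_sum F _ _).trans (.sum (map_idP F P)
      ((map_sum F _ _).trans (.sum (map_symP F Q P) (map_idP F Q))))).trans
        (HRel.cast_self _ _ _).symm)
  | cobang_nat f =>
    exact ((HRel.comp (map_cobangP F _) .same).trans ((HRel.of (.cobang_nat _)).trans
      (map_cobangP F _).symm)).rel
  | codiag_nat f =>
    exact ((HRel.comp (map_codiagP F _) .same).trans ((HRel.of (.codiag_nat _)).trans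
      (HRel.comp (map_sum F _ _) (map_codiagP F _)).symm)).rel
  | diag_assoc p q P =>
    have h2 := map_idP F P
    exact ((map_cast F _ _ ((diagP p P).comp ((diagP q P).sum (idP P)))).trans
      ((HRel.comp (map_diagP F p P)
      ((map_sum F _ _).trans (.sum (map_diagP F q P) h2))).trans
        ((HRel.cast_self _ _ _).symm.trans ((HRel.of (.diag_assoc p q _)).trans
          (HRel.comp (map_diagP F _ P)
            ((map_sum F _ _).trans (.sum h2 (map_diagP F _ P)))).symm)))).rel
  | diag_idem p P =>
    exact ((HRel.comp (map_diagP F p P) (map_codiagP F P)).trans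
      ((HRel.of (.diag_idem p _)).trans (map_idP F P).symm)).rel
  | diag_sym p P =>
    exact ((HRel.comp (map_diagP F p P) (map_symP F P P)).trans
      ((HRel.of (.diag_sym p _)).trans (map_diagP F _ P).symm)).rel
  | bang_coh P Q =>
    exact ((map_bangP F _).trans ((bangP_congr List.map_append).trans
      ((HRel.of (.bang_coh _ _)).trans
        ((map_sum F _ _).trans (.sum (map_bangP F P) (map_bangP F Q))).symm))).rel
  | diag_coh p P Q =>
    refine ((map_diagP F p _).trans ((diagP_congr p List.map_append).trans
      ((HRel.of (.diag_coh p _ _)).trans (HRel.symm (.comp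
        ((map_sum F _ _).trans (.sum (map_diagP F p P) (map_diagP F p Q))) ?_))))).rel
    exact (map_cast F _ _ _).trans (((map_sum F _ _).trans (.sum (map_idP F P)
      ((map_sum F _ _).trans (.sum (map_symP F P Q) (map_idP F Q))))).trans
        (HRel.cast_self _ _ _).symm)
  | bang_nat f =>
    exact ((HRel.comp .same (map_bangP F _)).trans ((HRel.of (.bang_nat _)).trans
      (map_bangP F _).symm)).rel
  | diag_nat p f =>
    exact ((HRel.comp .same (map_diagP F p _)).trans ((HRel.of (.diag_nat p _)).trans
      (HRel.comp (map_diagP F p _) (map_sum F _ _)).symm)).rel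
  | tape_id U =>
    change Rel (tape (F.map (𝟙 U))) (idObj (F.obj U))
    rw [F.map_id]; exact .tape_id _
  | tape_comp c d =>
    change Rel (tape (F.map (c ≫ d))) ((tape (F.map c)).comp (tape (F.map d)))
    rw [F.map_comp]; exact .tape_comp _ _

theorem map_id {P Q : List C} (t : TapeTerm C P Q) : HRel (t.map (𝟭 C)) t := by
  induction t with
  | comp t s ht hs => exact .comp ht hs
  | sum t s ht hs => exact (map_sum _ t s).trans (.sum ht hs)
  | _ => exact .same

theorem map_comp {E : Type*} [Category E] (F : C ⥤ D) (G : D ⥤ E) {P Q : List C}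
    (t : TapeTerm C P Q) : HRel (t.map (F ⋙ G)) ((t.map F).map G) := by
  induction t with
  | comp t s ht hs => exact .comp ht hs
  | sum t s ht hs =>
    exact (map_sum _ t s).trans ((HRel.sum ht hs).trans
      ((map_cast G _ _ _).trans (map_sum G (t.map F) (s.map F))).symm)
  | _ => exact .same

end TapeTerm

namespace Tape

open TapeTerm

variable {C : Type u} [Category.{v} C] {D : Type u'} [Category.{w} D]

/-- The functor `T(F) : T(C) ⥤ T(D)`. -/
def map (F : C ⥤ D) : Tape C ⥤ Tape D where
  obj P := List.map F.obj P
  map {P Q} := Quotient.map (TapeTerm.map F) fun _ _ h => h.map F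
  map_id P := mk_eq (map_idP F P).rel
  map_comp := by rintro P Q R ⟨f⟩ ⟨g⟩; rfl

theorem map_mk (F : C ⥤ D) {P Q : Tape C} (t : TapeTerm C P Q) :
    (map F).map (mk t) = mk (t.map F) := rfl

theorem mk_heq {P Q P' Q' : Tape C} {t : TapeTerm C P Q} {s : TapeTerm C P' Q'}
    (h : HRel t s) : mk t ≍ mk s := by
  obtain ⟨rfl, rfl, h⟩ := h
  exact heq_of_eq (mk_eq h)

theorem map_id : map (𝟭 C) = 𝟭 (Tape C) := by
  refine CategoryTheory.Functor.hext (fun P => List.map_id P) fun P Q f => ?_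
  obtain ⟨f, rfl⟩ := mk_surj f
  exact mk_heq (TapeTerm.map_id f)

theorem map_comp {E : Type*} [Category E] (F : C ⥤ D) (G : D ⥤ E) :
    map (F ⋙ G) = map F ⋙ map G := by
  refine CategoryTheory.Functor.hext (fun P => by simp [map]) fun P Q f => ?_
  obtain ⟨f, rfl⟩ := mk_surj f
  exact mk_heq (TapeTerm.map_comp F G f)

theorem map_isStrictSumFunctor (F : C ⥤ D) : IsStrictSumFunctor (map F) where
  obj_zero := rfl
  obj_sum P Q := List.map_append
  map_inl P Q := by
    have h₁ : inl P Q = mk (cast (List.append_nil P) rfl ((idP P).sum (cobangP Q))) := by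
      rw [mk_cast]; simp; rfl
    have h₂ (P Q : Tape D) :
        inl P Q = mk (cast (List.append_nil P) rfl ((idP P).sum (cobangP Q))) := by
      rw [mk_cast]; simp; rfl
    change (map F).map (inl P Q) = inl (List.map F.obj P) (List.map F.obj Q) ≫ _
    rw [h₁, h₂, map_mk]
    refine eq_of_heq (HEq.trans (mk_heq ?_) (comp_eqToHom_heq _ _).symm)
    exact (map_cast F _ _ _).trans (((map_sum F _ _).trans
      (.sum (map_idP F P) (map_cobangP F Q))).trans (HRel.cast_self _ _ _).symm)
  map_inr P Q := by
    change (map F).map (mk ((cobangP P).sum (idP Q))) =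
      mk ((cobangP (List.map F.obj P)).sum (idP (List.map F.obj Q))) ≫ _
    rw [map_mk]
    refine eq_of_heq (HEq.trans (mk_heq ?_) (comp_eqToHom_heq _ _).symm)
    exact (map_sum F _ _).trans (.sum (map_cobangP F P) (map_idP F Q))

theorem map_isPCAFunctor (F : C ⥤ D) : IsPCAFunctor (map F) where
  map_star P Q := mk_eq (HRel.comp (map_bangP F P) (map_cobangP F Q)).rel
  map_conv {P Q} p f g := by
    obtain ⟨f, rfl⟩ := mk_surj f
    obtain ⟨g, rfl⟩ := mk_surj g
    exact mk_eq (t := ((diagP p P).comp ((f.sum g).comp (codiagP Q))).map F)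
      (s := (diagP p (List.map F.obj P)).comp (((f.map F).sum (g.map F)).comp
        (codiagP (List.map F.obj Q))))
      (HRel.comp (map_diagP F p P) (.comp (map_sum F f g) (map_codiagP F Q))).rel

/-- The functor `η_C : C ⥤ T(C)` that sends an object to the corresponding one-letter word and
an arrow `c` to the class of `tape c`. -/
def unit (C : Type u) [Category.{v} C] : C ⥤ Tape C where
  obj U := [U]
  map c := mk (tape c)
  map_id U := mk_eq ((Rel.tape_id U).trans (Rel.symm (.sum_zero (idObj U))))
  map_comp c d := mk_eq (.tape_comp c d)

/-- Precomposition with the unit, from the category of morphisms of convex biproduct categories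
`T(C) ⥤ D` to the category of functors `C ⥤ D`. -/
def precompUnit (C : Type u) [Category.{v} C] (D : Type u') [Category.{w} D] [PCAEnriched D] :
    CBFunctor (Tape C) D ⥤ (C ⥤ D) :=
  (isCBFunctor (Tape C) D).ι ⋙ (Functor.whiskeringLeft C (Tape C) D).obj (unit C)

end Tape

/-- The assignment `C ↦ T(C)`, `F ↦ T(F)` as a functor to convex biproduct categories, given that
each `T(C)` is a convex biproduct category. -/
def tapeFunctor
    (h : ∀ (C : Type u) [Category.{v} C], ConvexBiproductCategory (Tape C)) :
    Cat.{v, u} ⥤ CBCat.{max u v, u} where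
  obj C := { carrier := Tape C, cb := h C }
  map F := ⟨Tape.map F.toFunctor, Tape.map_isPCAFunctor _,
    (Tape.map_isStrictSumFunctor _).preservesFiniteCoproducts⟩
  map_id _ := ObjectProperty.FullSubcategory.ext Tape.map_id
  map_comp _ _ := ObjectProperty.FullSubcategory.ext (Tape.map_comp _ _)

/-- The same functor with values in strict convex biproduct categories: the chosen coproducts of
`T(C)` are given by concatenation of words. -/
def strictTapeFunctor
    (h : ∀ (C : Type u) [Category.{v} C], ConvexBiproductCategory (Tape C)) :
    Cat.{v, u} ⥤ StrictCBCat.{max u v, u} where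
  obj C := { carrier := Tape C, cb := h C }
  map F := ⟨Tape.map F.toFunctor, Tape.map_isPCAFunctor _, Tape.map_isStrictSumFunctor _⟩
  map_id _ := Subtype.ext Tape.map_id
  map_comp _ _ := Subtype.ext (Tape.map_comp _ _)

/-! Call an interpretation of `C` in a `PCA`-enriched category a choice of coproducts for all words
together with a functorial choice of arrows for the letters (`WordModel`). The structural terms then
have a forced meaning: `codiag` and `sym` are copairings, `bang` and `cobang` are `star`, and `diag
p` is the convex combination of the two injections. Every axiom can be tested on injections, where
the co-pca axioms become the pca axioms of a hom-set. Hence each interpretation gives a functor out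
of `T(C)` (`WordModel.interp_eq_of_rel`). This is used twice.

The hard point of the first claim is uniqueness in convex products. With weight one half, `π₁ ; ι₁`
and `π₂ ; ι₂` combine to the half of the identity, so the projections of an arrow determine its
half. It remains to cancel `+_p star`, which is impossible in some pcas, such as semilattices. It is
possible in `T(C)` because the hom-set from a letter `U` to a word `P` is the free pca on the
entries, that is, the arrows of `C` from `U` to letters of `P`. Entries generate
(`Tape.gen_ofEntry`). The interpretation of words by the real vector spaces on their entries sends
entries to basis vectors (`Tape.weights_ofEntry`). An affine map from a pca that sends generators to
a basis is injective (`PCA.injective_of_gen`). So these hom-sets embed in vector spaces, which gives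
cancellation and also local smallness.

For the universal property, the coproducts of the target category give an interpretation that
extends any functor. Conversely all arrows of `T(C)` arise from letters and injections by
composition, `star`, convex combination and copairing (`Tape.hom_induction`). Hence natural
transformations extend uniquely from letters, and strict morphisms that agree on letters are equal.
-/

/-! ## Interpretations of tapes -/

/-- An interpretation of the words over `C` and of the arrows of `C` in a `PCA`-enriched category:
the word `U :: P` is a coproduct of `[U]` and `P`, and the empty word is a zero object. -/
structure WordModel (C : Type u) [Category.{v} C] (D : Type u') [Category.{w} D]
    [PCAEnriched D] where
  obj : List C → D
  head : ∀ (U : C) (P : List C), obj [U] ⟶ obj (U :: P)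
  tail : ∀ (U : C) (P : List C), obj P ⟶ obj (U :: P)
  head_nil : ∀ U : C, head U [] = 𝟙 _
  id_nil : 𝟙 (obj []) = PCA.star
  cons_coproduct : ∀ (U : C) (P : List C),
    Nonempty (IsColimit (BinaryCofan.mk (head U P) (tail U P)))
  gen : ∀ {U V : C}, (U ⟶ V) → (obj [U] ⟶ obj [V])
  gen_id : ∀ U : C, gen (𝟙 U) = 𝟙 _
  gen_comp : ∀ {U V W : C} (c : U ⟶ V) (d : V ⟶ W), gen (c ≫ d) = gen c ≫ gen d

namespace WordModel

variable {C : Type u} [Category.{v} C] {D : Type u'} [Category.{w} D] [PCAEnriched D]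
  (M : WordModel C D)

/-- Since the identity of the empty word is `star` and composition absorbs `star`, every arrow out
of the empty word is `star`. The same holds for arrows into it, so the enrichment alone makes it a
zero object. -/
theorem from_nil_ext {X : D} (f g : M.obj [] ⟶ X) : f = g := by
  rw [← Category.id_comp f, ← Category.id_comp g, M.id_nil, PCAEnriched.star_comp,
    PCAEnriched.star_comp]

theorem to_nil_ext {X : D} (f g : X ⟶ M.obj []) : f = g := by
  rw [← Category.comp_id f, ← Category.comp_id g, M.id_nil, PCAEnriched.comp_star,
    PCAEnriched.comp_star]

theorem cons_ext {U : C} {P : List C} {X : D} {f g : M.obj (U :: P) ⟶ X}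
    (h : M.head U P ≫ f = M.head U P ≫ g) (h' : M.tail U P ≫ f = M.tail U P ≫ g) : f = g :=
  BinaryCofan.IsColimit.hom_ext (M.cons_coproduct U P).some h h'

theorem exists_consDesc {U : C} {P : List C} {X : D} (f : M.obj [U] ⟶ X) (g : M.obj P ⟶ X) :
    ∃ k, M.head U P ≫ k = f ∧ M.tail U P ≫ k = g :=
  ⟨_, (BinaryCofan.IsColimit.desc' (M.cons_coproduct U P).some f g).2⟩

/-- The arrow induced by the coproduct `U :: P`. -/
noncomputable def consDesc {U : C} {P : List C} {X : D} (f : M.obj [U] ⟶ X) (g : M.obj P ⟶ X) :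
    M.obj (U :: P) ⟶ X :=
  (M.exists_consDesc f g).choose

@[simp]
theorem head_consDesc {U : C} {P : List C} {X : D} (f : M.obj [U] ⟶ X) (g : M.obj P ⟶ X) :
    M.head U P ≫ M.consDesc f g = f :=
  (M.exists_consDesc f g).choose_spec.1

@[simp]
theorem tail_consDesc {U : C} {P : List C} {X : D} (f : M.obj [U] ⟶ X) (g : M.obj P ⟶ X) :
    M.tail U P ≫ M.consDesc f g = g :=
  (M.exists_consDesc f g).choose_spec.2

@[simp]
theorem head_consDesc_assoc {U : C} {P : List C} {X Y : D} (f : M.obj [U] ⟶ X) (g : M.obj P ⟶ X)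
    (k : X ⟶ Y) : M.head U P ≫ M.consDesc f g ≫ k = f ≫ k := by
  rw [← Category.assoc, head_consDesc]

@[simp]
theorem tail_consDesc_assoc {U : C} {P : List C} {X Y : D} (f : M.obj [U] ⟶ X) (g : M.obj P ⟶ X)
    (k : X ⟶ Y) : M.tail U P ≫ M.consDesc f g ≫ k = g ≫ k := by
  rw [← Category.assoc, tail_consDesc]

/-! ### Injections into concatenations -/

/-- The first injection into a concatenation. -/
noncomputable def inl : (P Q : List C) → (M.obj P ⟶ M.obj (P ++ Q))
  | [], _ => PCA.star
  | U :: P, Q => M.consDesc (M.head U (P ++ Q)) (inl P Q ≫ M.tail U (P ++ Q))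

/-- The second injection into a concatenation. -/
def inr : (P Q : List C) → (M.obj Q ⟶ M.obj (P ++ Q))
  | [], _ => 𝟙 _
  | U :: P, Q => inr P Q ≫ M.tail U (P ++ Q)

theorem inl_cons (U : C) (P Q : List C) :
    M.inl (U :: P) Q = M.consDesc (M.head U (P ++ Q)) (M.inl P Q ≫ M.tail U (P ++ Q)) := rfl

theorem inr_cons (U : C) (P Q : List C) : M.inr (U :: P) Q = M.inr P Q ≫ M.tail U (P ++ Q) := rfl

theorem inl_singleton (U : C) (P : List C) : M.inl [U] P = M.head U P := by
  have := M.head_consDesc (M.head U ([] ++ P)) (M.inl [] P ≫ M.tail U ([] ++ P))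
  rw [head_nil, Category.id_comp] at this
  exact this

theorem inr_singleton (U : C) (P : List C) : M.inr [U] P = M.tail U P := Category.id_comp _

/-- Peeling off the letters of `P` reduces this to the coproducts `U :: P`. All later identities
between interpreted arrows are checked through it, one summand at a time. -/
theorem hom_ext {P Q : List C} {X : D} {f g : M.obj (P ++ Q) ⟶ X}
    (h : M.inl P Q ≫ f = M.inl P Q ≫ g) (h' : M.inr P Q ≫ f = M.inr P Q ≫ g) : f = g := by
  induction P with
  | nil => simpa [inr] using h'
  | cons U P ih =>
    refine M.cons_ext ?_ (ih ?_ ?_)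
    · simpa [inl_cons] using congrArg (M.head U P ≫ ·) h
    · simpa [inl_cons] using congrArg (M.tail U P ≫ ·) h
    · simpa [inr_cons] using h'

theorem exists_desc {P Q : List C} {X : D} (f : M.obj P ⟶ X) (g : M.obj Q ⟶ X) :
    ∃ k, M.inl P Q ≫ k = f ∧ M.inr P Q ≫ k = g := by
  induction P with
  | nil => exact ⟨g, M.from_nil_ext _ _, Category.id_comp _⟩
  | cons U P ih =>
    obtain ⟨k, hk, hk'⟩ := ih (M.tail U P ≫ f)
    refine ⟨M.consDesc (M.head U P ≫ f) k, M.cons_ext ?_ ?_, ?_⟩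
    · simp [inl_cons]
    · simpa [inl_cons] using hk
    · simpa [inr_cons] using hk'

/-- The arrow induced by the coproduct `P ++ Q`. -/
noncomputable def desc {P Q : List C} {X : D} (f : M.obj P ⟶ X) (g : M.obj Q ⟶ X) :
    M.obj (P ++ Q) ⟶ X :=
  (M.exists_desc f g).choose

@[simp]
theorem inl_desc {P Q : List C} {X : D} (f : M.obj P ⟶ X) (g : M.obj Q ⟶ X) :
    M.inl P Q ≫ M.desc f g = f :=
  (M.exists_desc f g).choose_spec.1

@[simp]
theorem inr_desc {P Q : List C} {X : D} (f : M.obj P ⟶ X) (g : M.obj Q ⟶ X) :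
    M.inr P Q ≫ M.desc f g = g :=
  (M.exists_desc f g).choose_spec.2

@[simp]
theorem inl_desc_assoc {P Q : List C} {X Y : D} (f : M.obj P ⟶ X) (g : M.obj Q ⟶ X) (k : X ⟶ Y) :
    M.inl P Q ≫ M.desc f g ≫ k = f ≫ k := by
  rw [← Category.assoc, inl_desc]

@[simp]
theorem inr_desc_assoc {P Q : List C} {X Y : D} (f : M.obj P ⟶ X) (g : M.obj Q ⟶ X) (k : X ⟶ Y) :
    M.inr P Q ≫ M.desc f g ≫ k = g ≫ k := by
  rw [← Category.assoc, inr_desc]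

theorem isColimit_append (P Q : List C) :
    Nonempty (IsColimit (BinaryCofan.mk (M.inl P Q) (M.inr P Q))) :=
  ⟨BinaryCofan.isColimitMk (fun s => M.desc s.inl s.inr) (fun _ => M.inl_desc _ _)
    (fun _ => M.inr_desc _ _)
    (fun _ _ e₁ e₂ => M.hom_ext (e₁.trans (M.inl_desc _ _).symm)
      (e₂.trans (M.inr_desc _ _).symm))⟩

/-- Transport along an equality of words. -/
def eqTo {P Q : List C} (h : P = Q) : M.obj P ⟶ M.obj Q := eqToHom (congrArg M.obj h)

@[simp]
theorem eqTo_refl {P : List C} (h : P = P) : M.eqTo h = 𝟙 _ := rfl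

@[simp]
theorem eqTo_trans {P Q R : List C} (h : P = Q) (h' : Q = R) :
    M.eqTo h ≫ M.eqTo h' = M.eqTo (h.trans h') := by
  subst h h'; simp

theorem tail_eqTo (U : C) {P Q : List C} (h : P = Q) :
    M.tail U P ≫ M.eqTo (congrArg (U :: ·) h) = M.eqTo h ≫ M.tail U Q := by
  subst h; simp

theorem head_eqTo (U : C) {P Q : List C} (h : P = Q) :
    M.head U P ≫ M.eqTo (congrArg (U :: ·) h) = M.head U Q := by
  subst h; simp

theorem inl_nil_right (P : List C) : M.inl P [] = M.eqTo (List.append_nil P).symm := by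
  induction P with
  | nil => exact M.from_nil_ext _ _
  | cons U P ih =>
    refine M.cons_ext ?_ ?_
    · rw [inl_cons, head_consDesc]
      exact (M.head_eqTo U (List.append_nil P).symm).symm
    · rw [inl_cons, tail_consDesc, ih]
      exact (M.tail_eqTo U (List.append_nil P).symm).symm

theorem inr_nil_left (P : List C) : M.inr [] P = 𝟙 _ := rfl

theorem inl_inl (P Q R : List C) :
    M.inl P Q ≫ M.inl (P ++ Q) R = M.inl P (Q ++ R) ≫ M.eqTo (List.append_assoc P Q R).symm := by
  induction P with
  | nil => exact M.from_nil_ext _ _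
  | cons U P ih =>
    refine M.cons_ext ?_ ?_
    · have := M.head_eqTo U (List.append_assoc P Q R).symm
      simp only [List.cons_append, inl_cons, head_consDesc_assoc, head_consDesc, this]
    · have := M.tail_eqTo U (List.append_assoc P Q R).symm
      simp only [List.cons_append, inl_cons, tail_consDesc_assoc, tail_consDesc, Category.assoc,
        this]
      rw [← Category.assoc, ih, Category.assoc]

theorem inr_inl (P Q R : List C) :
    M.inr P Q ≫ M.inl (P ++ Q) R =
      M.inl Q R ≫ M.inr P (Q ++ R) ≫ M.eqTo (List.append_assoc P Q R).symm := by
  induction P with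
  | nil => simp [inr_nil_left]
  | cons U P ih =>
    have := M.tail_eqTo U (List.append_assoc P Q R).symm
    simp only [List.cons_append, inl_cons, inr_cons, tail_consDesc, Category.assoc, this]
    rw [← Category.assoc, ih]
    simp

theorem inr_append (P Q R : List C) :
    M.inr (P ++ Q) R = M.inr Q R ≫ M.inr P (Q ++ R) ≫ M.eqTo (List.append_assoc P Q R).symm := by
  induction P with
  | nil => simp [inr_nil_left]
  | cons U P ih =>
    have := M.tail_eqTo U (List.append_assoc P Q R).symm
    simp only [List.cons_append, inr_cons, Category.assoc, this]
    rw [ih]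
    simp

/-- The injection of the middle part of a word. -/
noncomputable def inj (A P B W : List C) (h : A ++ (P ++ B) = W) : M.obj P ⟶ M.obj W :=
  M.inl P B ≫ M.inr A (P ++ B) ≫ M.eqTo h

theorem inl_eq_inj (P Q : List C) : M.inl P Q = M.inj [] P Q (P ++ Q) rfl := by
  simp [inj, inr_nil_left]

theorem eqTo_inr (A : List C) {P Q : List C} (h : P = Q) :
    M.eqTo h ≫ M.inr A Q = M.inr A P ≫ M.eqTo (congrArg (A ++ ·) h) := by
  subst h; simp

theorem eqTo_inr_assoc (A : List C) {P Q : List C} (h : P = Q) {X : D}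
    (f : M.obj (A ++ Q) ⟶ X) :
    M.eqTo h ≫ M.inr A Q ≫ f = M.inr A P ≫ M.eqTo (congrArg (A ++ ·) h) ≫ f := by
  subst h; simp

theorem inr_eq_inj (P Q : List C) : M.inr P Q = M.inj P Q [] (P ++ Q) (by simp) := by
  rw [inj, inl_nil_right, eqTo_inr_assoc]
  simp

/-- The target word of `inj` is a variable tied to the concatenation by an equation, so transports
disappear into that equation. This lets `simp` ignore associativity of words. -/
theorem inj_eqTo {A P B W W' : List C} (h : A ++ (P ++ B) = W) (h' : W = W') :
    M.inj A P B W h ≫ M.eqTo h' = M.inj A P B W' (h.trans h') := by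
  subst h'; simp

/-- Nested inclusions of a subword merge their contexts. Any composite of injections and transports
thus has a normal form given by the words to the left and to the right of the included one. -/
theorem inj_comp {A P B W A' B' W' : List C} (h : A ++ (P ++ B) = W) (h' : A' ++ (W ++ B') = W') :
    M.inj A P B W h ≫ M.inj A' W B' W' h' =
      M.inj (A' ++ A) P (B ++ B') W' (by rw [← h', ← h]; simp) := by
  subst h h'
  have e₁ := M.inr_inl A (P ++ B) B'
  have e₂ := M.inl_inl P B B'
  simp only [inj, eqTo_refl, Category.comp_id, Category.assoc]
  rw [← Category.assoc (M.inr A _), e₁]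
  simp only [Category.assoc]
  rw [← Category.assoc (M.inl P B), e₂]
  simp only [Category.assoc, M.inr_append A' A, eqTo_inr, eqTo_inr_assoc, eqTo_trans]

theorem inj_self (P : List C) (h : [] ++ (P ++ []) = P) : M.inj [] P [] P h = 𝟙 _ := by
  simp [inj, inl_nil_right, inr_nil_left]

/-! ### Sums of arrows -/

/-- The sum of two arrows. -/
noncomputable def tensor {P Q P' Q' : List C} (f : M.obj P ⟶ M.obj P') (g : M.obj Q ⟶ M.obj Q') :
    M.obj (P ++ Q) ⟶ M.obj (P' ++ Q') :=
  M.desc (f ≫ M.inl P' Q') (g ≫ M.inr P' Q')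

/-- The interpretation of a term. -/
noncomputable def interp : {P Q : List C} → TapeTerm C P Q → (M.obj P ⟶ M.obj Q)
  | _, _, .diag p U => PCA.conv p (M.inl [U] [U]) (M.inr [U] [U])
  | _, _, .bang _ => PCA.star
  | _, _, .tape c => M.gen c
  | _, _, .cobang _ => PCA.star
  | _, _, .codiag U => M.desc (P := [U]) (Q := [U]) (𝟙 _) (𝟙 _)
  | _, _, .idObj _ => 𝟙 _
  | _, _, .idZero => 𝟙 _
  | _, _, .sym U V => M.desc (P := [U]) (Q := [V]) (M.inr [V] [U]) (M.inl [V] [U])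
  | _, _, .comp t s => interp t ≫ interp s
  | _, _, .sum t s => M.tensor (interp t) (interp s)

theorem interp_cast {P Q P' Q' : List C} (hP : P = P') (hQ : Q = Q') (t : TapeTerm C P Q) :
    M.interp (t.cast hP hQ) = M.eqTo hP.symm ≫ M.interp t ≫ M.eqTo hQ := by
  subst hP hQ
  simp [TapeTerm.cast]

end WordModel

/-! ### Coherence laws for sums of interpreted arrows -/

namespace WordModel

variable {C : Type u} [Category.{v} C] {D : Type u'} [Category.{w} D] [PCAEnriched D]
  (M : WordModel C D)

section Inj

variable {X : D} {A B P Q R W : List C} (f : M.obj Q ⟶ X) (g : M.obj R ⟶ X)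

/-- A subword that lies inside one summand only meets the corresponding component of a copairing.
The primed and `first` variants are the cases of empty contexts, stated separately because `simp`
matches the shape of the words syntactically. -/
theorem inj_desc_left (h : A ++ (P ++ (B ++ R)) = Q ++ R) :
    M.inj A P (B ++ R) (Q ++ R) h ≫ M.desc f g =
      M.inj A P B Q (by simpa [← List.append_assoc] using h) ≫ f := by
  obtain rfl : A ++ (P ++ B) = Q := by simpa [← List.append_assoc] using h
  have := M.inj_comp (A := A) (P := P) (B := B) rfl
    (show [] ++ ((A ++ (P ++ B)) ++ R) = (A ++ (P ++ B)) ++ R from rfl)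
  simp only [List.nil_append] at this
  rw [← this, ← inl_eq_inj, Category.assoc, inl_desc]

theorem inj_desc_left' (h : A ++ (P ++ R) = Q ++ R) :
    M.inj A P R (Q ++ R) h ≫ M.desc f g =
      M.inj A P [] Q (by simpa [← List.append_assoc] using h) ≫ f :=
  M.inj_desc_left (B := []) f g h

theorem inj_desc_right (h : (Q ++ A) ++ (P ++ B) = Q ++ R) :
    M.inj (Q ++ A) P B (Q ++ R) h ≫ M.desc f g =
      M.inj A P B R (by simpa using h) ≫ g := by
  obtain rfl : A ++ (P ++ B) = R := by simpa using h
  have := M.inj_comp (A := A) (P := P) (B := B) rfl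
    (show Q ++ ((A ++ (P ++ B)) ++ []) = Q ++ (A ++ (P ++ B)) by simp)
  simp only [List.append_nil] at this
  rw [← this, ← inr_eq_inj, Category.assoc, inr_desc]

theorem inj_desc_right' (h : Q ++ (P ++ B) = Q ++ R) :
    M.inj Q P B (Q ++ R) h ≫ M.desc f g = M.inj [] P B R (by simpa using h) ≫ g := by
  have := M.inj_desc_right (A := []) (P := P) (B := B) f g (by simpa using h)
  simpa only [List.append_nil] using this

theorem inj_desc_first (h : [] ++ (Q ++ B) = Q ++ R) :
    M.inj [] Q B (Q ++ R) h ≫ M.desc f g = f := by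
  obtain rfl : B = R := by simpa using h
  rw [← inl_eq_inj, inl_desc]

/-- The left context is bracketed to the right here, as `inj_comp` and `simp` leave it, so
`inj_desc_right` does not match it. -/
theorem inj_desc_right_append {Q' : List C} (f : M.obj (Q ++ Q') ⟶ X)
    (h : (Q ++ (Q' ++ A)) ++ (P ++ B) = (Q ++ Q') ++ R) :
    M.inj (Q ++ (Q' ++ A)) P B ((Q ++ Q') ++ R) h ≫ M.desc f g =
      M.inj A P B R (by simpa using h) ≫ g := by
  rw [← inj_desc_right (Q := Q ++ Q') M f g (by simpa using h)]
  simp only [List.append_assoc]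

end Inj

section InjAssoc

variable {X Y : D} {A B P Q R W W' : List C} (f : M.obj Q ⟶ X) (g : M.obj R ⟶ X) (k : X ⟶ Y)

theorem inj_desc_left_assoc (h : A ++ (P ++ (B ++ R)) = Q ++ R) :
    M.inj A P (B ++ R) (Q ++ R) h ≫ M.desc f g ≫ k =
      M.inj A P B Q (by simpa [← List.append_assoc] using h) ≫ f ≫ k := by
  rw [← Category.assoc, inj_desc_left, Category.assoc]

theorem inj_desc_left'_assoc (h : A ++ (P ++ R) = Q ++ R) :
    M.inj A P R (Q ++ R) h ≫ M.desc f g ≫ k =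
      M.inj A P [] Q (by simpa [← List.append_assoc] using h) ≫ f ≫ k := by
  rw [← Category.assoc, inj_desc_left', Category.assoc]

theorem inj_desc_right_assoc (h : (Q ++ A) ++ (P ++ B) = Q ++ R) :
    M.inj (Q ++ A) P B (Q ++ R) h ≫ M.desc f g ≫ k =
      M.inj A P B R (by simpa using h) ≫ g ≫ k := by
  rw [← Category.assoc, inj_desc_right, Category.assoc]

theorem inj_desc_right'_assoc (h : Q ++ (P ++ B) = Q ++ R) :
    M.inj Q P B (Q ++ R) h ≫ M.desc f g ≫ k = M.inj [] P B R (by simpa using h) ≫ g ≫ k := by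
  rw [← Category.assoc, inj_desc_right', Category.assoc]

theorem inj_desc_first_assoc (h : [] ++ (Q ++ B) = Q ++ R) :
    M.inj [] Q B (Q ++ R) h ≫ M.desc f g ≫ k = f ≫ k := by
  rw [← Category.assoc, inj_desc_first]

theorem inj_eqTo_assoc (h : A ++ (P ++ B) = W) (h' : W = W') (f : M.obj W' ⟶ X) :
    M.inj A P B W h ≫ M.eqTo h' ≫ f = M.inj A P B W' (h.trans h') ≫ f := by
  rw [← Category.assoc, inj_eqTo]

theorem inj_comp_assoc {A' B' : List C} (h : A ++ (P ++ B) = W) (h' : A' ++ (W ++ B') = W')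
    (f : M.obj W' ⟶ X) :
    M.inj A P B W h ≫ M.inj A' W B' W' h' ≫ f =
      M.inj (A' ++ A) P (B ++ B') W' (by rw [← h', ← h]; simp) ≫ f := by
  rw [← Category.assoc, inj_comp]

end InjAssoc

/-- The symmetry. -/
noncomputable def symm (P Q : List C) : M.obj (P ++ Q) ⟶ M.obj (Q ++ P) :=
  M.desc (M.inr Q P) (M.inl Q P)

/-- The codiagonal. -/
noncomputable def codiag (P : List C) : M.obj (P ++ P) ⟶ M.obj P := M.desc (𝟙 _) (𝟙 _)

/-- The convex combination of the two injections. -/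
noncomputable def diag (p : OpenUnit) (P : List C) : M.obj P ⟶ M.obj (P ++ P) :=
  PCA.conv p (M.inl P P) (M.inr P P)

-- Injections are rewritten to `inj`, and sums, symmetries, diagonals and codiagonals to copairings
-- and convex combinations. Each coherence law then reduces on every summand to equal normal forms.
-- The rules for `inl` and `inr` are switched off in favour of those for `inj`.
attribute [local simp] inj_desc_first inj_desc_first_assoc inj_desc_right_append inj_desc_left
 inj_desc_left' inj_desc_right inj_desc_right'
  inj_desc_left_assoc inj_desc_left'_assoc inj_desc_right_assoc inj_desc_right'_assoc inj_eqTo_assoc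
  inj_comp_assoc inj_self inj_comp inj_eqTo tensor PCAEnriched.comp_conv PCAEnriched.conv_comp
  inl_eq_inj inr_eq_inj symm codiag diag

attribute [-simp] inl_desc inr_desc inl_desc_assoc inr_desc_assoc

theorem tensor_id (P Q : List C) : M.tensor (𝟙 (M.obj P)) (𝟙 (M.obj Q)) = 𝟙 _ :=
  M.hom_ext (by simp) (by simp)

theorem tensor_comp {P Q R P' Q' R' : List C} (f : M.obj P ⟶ M.obj Q) (g : M.obj Q ⟶ M.obj R)
    (f' : M.obj P' ⟶ M.obj Q') (g' : M.obj Q' ⟶ M.obj R') :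
    M.tensor f f' ≫ M.tensor g g' = M.tensor (f ≫ g) (f' ≫ g') :=
  M.hom_ext (by simp) (by simp)

theorem tensor_assoc {P Q R P' Q' R' : List C} (f : M.obj P ⟶ M.obj P')
    (g : M.obj Q ⟶ M.obj Q') (h : M.obj R ⟶ M.obj R') :
    M.eqTo (List.append_assoc P Q R).symm ≫ M.tensor (M.tensor f g) h ≫
      M.eqTo (List.append_assoc P' Q' R') = M.tensor f (M.tensor g h) := by
  refine M.hom_ext ?_ (M.hom_ext ?_ ?_) <;> simp

/-- The two hexagons, and below them the laws for diagonals and codiagonals of concatenations, have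
the shape of the recursions that define `symOne`, `symP`, `diagP` and `codiagP`. -/
theorem symm_append_right (P Q R : List C) :
    M.eqTo (List.append_assoc P Q R).symm ≫ M.tensor (M.symm P Q) (𝟙 (M.obj R)) ≫
      M.eqTo (List.append_assoc Q P R) ≫ M.tensor (𝟙 (M.obj Q)) (M.symm P R) ≫
        M.eqTo (List.append_assoc Q R P).symm = M.symm P (Q ++ R) := by
  refine M.hom_ext ?_ (M.hom_ext ?_ ?_) <;> simp

theorem symm_append_left (P Q R : List C) :
    M.eqTo (List.append_assoc P Q R) ≫ M.tensor (𝟙 (M.obj P)) (M.symm Q R) ≫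
      M.eqTo (List.append_assoc P R Q).symm ≫ M.tensor (M.symm P R) (𝟙 (M.obj Q)) ≫
        M.eqTo (List.append_assoc R P Q) = M.symm (P ++ Q) R := by
  refine M.hom_ext (M.hom_ext ?_ ?_) ?_ <;> simp

theorem diag_append (p : OpenUnit) (P Q : List C) :
    M.tensor (M.diag p P) (M.diag p Q) ≫
      M.eqTo (by simp : (P ++ P) ++ (Q ++ Q) = P ++ ((P ++ Q) ++ Q)) ≫
        M.tensor (𝟙 (M.obj P)) (M.tensor (M.symm P Q) (𝟙 (M.obj Q))) ≫
          M.eqTo (by simp) = M.diag p (P ++ Q) := by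
  refine M.hom_ext ?_ ?_ <;> simp

theorem codiag_append (P Q : List C) :
      M.eqTo (by simp : (P ++ Q) ++ (P ++ Q) = P ++ ((Q ++ P) ++ Q)) ≫
        M.tensor (𝟙 (M.obj P)) (M.tensor (M.symm Q P) (𝟙 (M.obj Q))) ≫
          M.eqTo (by simp) ≫ M.tensor (M.codiag P) (M.codiag Q) = M.codiag (P ++ Q) := by
  refine M.hom_ext (M.hom_ext ?_ ?_) (M.hom_ext ?_ ?_) <;> simp

theorem symm_symm (P Q : List C) : M.symm P Q ≫ M.symm Q P = 𝟙 _ :=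
  M.hom_ext (by simp) (by simp)

theorem symm_nat {P Q : List C} (f : M.obj P ⟶ M.obj Q) (R : List C) :
    M.tensor f (𝟙 (M.obj R)) ≫ M.symm Q R = M.symm P R ≫ M.tensor (𝟙 (M.obj R)) f :=
  M.hom_ext (by simp) (by simp)

theorem codiag_assoc (P : List C) :
    M.tensor (𝟙 (M.obj P)) (M.codiag P) ≫ M.codiag P =
      M.eqTo (List.append_assoc P P P).symm ≫ M.tensor (M.codiag P) (𝟙 (M.obj P)) ≫
        M.codiag P := by
  refine M.hom_ext ?_ (M.hom_ext ?_ ?_) <;> simp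

theorem codiag_nat {P Q : List C} (f : M.obj P ⟶ M.obj Q) :
    M.codiag P ≫ f = M.tensor f f ≫ M.codiag Q :=
  M.hom_ext (by simp) (by simp)

theorem codiag_unit (P : List C) (f : M.obj [] ⟶ M.obj P) :
    M.tensor f (𝟙 (M.obj P)) ≫ M.codiag P = 𝟙 _ :=
  M.hom_ext (M.from_nil_ext _ _) (by rw [tensor, inr_desc_assoc]; simp)

theorem codiag_symm (P : List C) : M.symm P P ≫ M.codiag P = M.codiag P :=
  M.hom_ext (by simp) (by simp)

/-- Both sides are convex combinations of the three injections of `P` into its triple sum, so this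
is associativity in a hom-set. In the same way the other co-pca axioms come from idempotence,
commutativity and bilinearity of composition. -/
theorem diag_assoc (p q : OpenUnit) (P : List C) :
    M.diag p P ≫ M.tensor (M.diag q P) (𝟙 (M.obj P)) ≫ M.eqTo (List.append_assoc P P P) =
      M.diag (p.tildeP q) P ≫ M.tensor (𝟙 (M.obj P)) (M.diag (p.tildeQ q) P) := by
  simp [PCA.conv_assoc]

theorem diag_codiag (p : OpenUnit) (P : List C) : M.diag p P ≫ M.codiag P = 𝟙 _ := by
  simp [PCA.conv_idem]

theorem diag_symm (p : OpenUnit) (P : List C) :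
    M.diag p P ≫ M.symm P P = M.diag p.compl P := by
  simp [PCA.conv_comm p]

theorem diag_nat (p : OpenUnit) {P Q : List C} (f : M.obj P ⟶ M.obj Q) :
    f ≫ M.diag p Q = M.diag p P ≫ M.tensor f f := by
  simp

theorem zero_tensor {P Q : List C} (f : M.obj P ⟶ M.obj Q) :
    M.tensor (𝟙 (M.obj [])) f = f :=
  M.hom_ext (P := []) (M.from_nil_ext _ _) (by rw [tensor, inr_desc]; simp)

theorem tensor_zero {P Q : List C} (f : M.obj P ⟶ M.obj Q) :
    M.eqTo (List.append_nil P).symm ≫ M.tensor f (𝟙 (M.obj [])) ≫ M.eqTo (List.append_nil Q) =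
      f := by
  rw [← inl_nil_right, tensor, inl_desc_assoc, inl_nil_right]
  simp

end WordModel

/-! ### Soundness of the interpretation -/

namespace WordModel

variable {C : Type u} [Category.{v} C] {D : Type u'} [Category.{w} D] [PCAEnriched D]
  (M : WordModel C D)

open TapeTerm

theorem interp_idP (P : List C) : M.interp (idP P) = 𝟙 _ := by
  induction P with
  | nil => rfl
  | cons U P ih =>
    rw [idP, interp, ih]
    exact M.tensor_id [U] P

theorem symm_nil_right (P : List C) : M.symm P [] = M.eqTo (List.append_nil P) := by
  refine M.hom_ext ?_ (M.from_nil_ext _ _)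
  rw [symm, inl_desc, inl_nil_right]
  simp [inr_nil_left]

theorem symm_nil_left (P : List C) : M.symm [] P = M.eqTo (List.append_nil P).symm := by
  refine M.hom_ext (P := []) (M.from_nil_ext _ _) ?_
  rw [symm, inr_desc, inl_nil_right]
  simp [inr_nil_left]

/-- Structure terms on words are defined letter by letter, while their axioms speak of whole words.
Identifying them with copairings and convex combinations of injections makes the coherence laws for
words applicable. -/
theorem interp_symOne (U : C) (P : List C) : M.interp (symOne U P) = M.symm [U] P := by
  induction P with
  | nil => exact (M.symm_nil_right [U]).symm
  | cons V P ih =>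
    have := M.symm_append_right [U] [V] P
    rw [← ih, ← interp_idP] at this
    refine Eq.trans ?_ this
    -- When the leading words are single letters, the transports in the hexagon are identities by
    -- definition; they only have to be inserted.
    exact (Category.id_comp (M.interp (symOne U (V :: P)))).symm.trans (congrArg (𝟙 _ ≫ ·)
      (congrArg (M.tensor _ _ ≫ ·) ((Category.id_comp _).trans (Category.comp_id _)).symm))

theorem interp_symP (P Q : List C) : M.interp (symP P Q) = M.symm P Q := by
  induction P with
  | nil =>
    have := interp_idP M Q
    rw [symP, interp_cast, symm_nil_left]
    exact (Category.id_comp _).trans ((congrArg (· ≫ _) this).trans (Category.id_comp _))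
  | cons U P ih =>
    have := M.symm_append_left [U] P Q
    rw [← ih, ← interp_symOne, ← M.interp_idP P] at this
    rw [symP, interp_cast]
    refine Eq.trans ?_ this
    exact congrArg (𝟙 _ ≫ ·) ((Category.assoc _ _ _).trans
      (congrArg (M.tensor _ _ ≫ ·) (Category.id_comp _).symm))

theorem interp_diagP (p : OpenUnit) (P : List C) : M.interp (diagP p P) = M.diag p P := by
  induction P with
  | nil => exact M.to_nil_ext _ _
  | cons U P ih =>
    have := M.diag_append p [U] P
    rw [← ih, ← interp_symOne, ← M.interp_idP P] at this
    rw [diagP, interp, interp_cast]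
    exact this

theorem interp_codiagP (P : List C) : M.interp (codiagP P) = M.codiag P := by
  induction P with
  | nil => exact M.to_nil_ext _ _
  | cons U P ih =>
    have := M.codiag_append [U] P
    rw [← ih, ← interp_symP, ← M.interp_idP P] at this
    rw [codiagP, interp, interp_cast]
    refine Eq.trans ?_ this
    simp only [Category.assoc]
    exact congrArg (M.eqTo _ ≫ ·) (congrArg (M.tensor _ _ ≫ ·) rfl)

theorem interp_bangP (P : List C) : M.interp (bangP P) = PCA.star := M.to_nil_ext _ _

theorem interp_eq_of_rel {P Q : List C} {t s : TapeTerm C P Q} (h : Rel t s) :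
    M.interp t = M.interp s := by
  induction h with
  | refl t => rfl
  | symm _ ih => exact ih.symm
  | trans _ _ ih ih' => exact ih.trans ih'
  | comp_congr _ _ ih ih' => simp only [interp, ih, ih']
  | sum_congr _ _ ih ih' => simp only [interp, ih, ih']
  | comp_assoc f g h => exact Category.assoc _ _ _
  | id_comp f => rw [interp, interp_idP, Category.id_comp]
  | comp_id f => rw [interp, interp_idP, Category.comp_id]
  | interchange f₁ f₂ g₁ g₂ => exact M.tensor_comp _ _ _ _
  | zero_sum f => exact M.zero_tensor _
  | sum_zero f => rw [interp_cast]; exact M.tensor_zero _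
  | sum_assoc f g h => rw [interp_cast]; exact M.tensor_assoc _ _ _
  | sym_sym P Q => simp only [interp, interp_symP, interp_idP, symm_symm]
  | sym_nat f R => simp only [interp, interp_symP, interp_idP, symm_nat]
  | codiag_assoc P =>
    simp only [interp_cast, interp, interp_codiagP, interp_idP, M.codiag_assoc, eqTo_refl,
      Category.comp_id]
  | codiag_unit P =>
    simp only [interp, interp_codiagP, interp_idP, codiag_unit]
    exact (M.interp_idP P).symm
  | codiag_sym P => simp only [interp, interp_symP, interp_codiagP, codiag_symm]
  | cobang_coh P Q =>
    exact M.from_nil_ext _ _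
  | codiag_coh P Q =>
    simp only [interp, interp_cast, interp_symP, interp_codiagP, interp_idP, ← codiag_append,
      Category.assoc]
  | cobang_nat f => exact M.from_nil_ext _ _
  | codiag_nat f => simp only [interp, interp_codiagP, codiag_nat]
  | diag_assoc p q P =>
    simp only [interp_cast, interp, interp_diagP, interp_idP, ← M.diag_assoc, Category.assoc,
      eqTo_refl, Category.id_comp]
  | diag_idem p P => simp only [interp, interp_diagP, interp_codiagP, interp_idP, diag_codiag]
  | diag_sym p P => simp only [interp, interp_diagP, interp_symP, diag_symm]
  | bang_coh P Q => exact M.to_nil_ext _ _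
  | diag_coh p P Q =>
    simp only [interp, interp_cast, interp_symP, interp_diagP, interp_idP, ← diag_append]
  | bang_nat f => exact M.to_nil_ext _ _
  | diag_nat p f => simp only [interp, interp_diagP, diag_nat]
  | tape_id U => exact M.gen_id U
  | tape_comp c d => exact M.gen_comp c d

/-- The functor from tapes induced by an interpretation. -/
noncomputable def functor : Tape C ⥤ D where
  obj P := M.obj P
  map := Quotient.lift M.interp fun _ _ h => M.interp_eq_of_rel h
  map_id P := M.interp_idP P
  map_comp := by rintro P Q R ⟨f⟩ ⟨g⟩; rfl

theorem functor_map_mk {P Q : Tape C} (t : TapeTerm C P Q) :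
    M.functor.map (Tape.mk t) = M.interp t := rfl

theorem functor_map_inl (P Q : Tape C) : M.functor.map (Tape.inl P Q) = M.inl P Q := by
  have h : Tape.inl P Q =
      Tape.mk (cast (List.append_nil P) rfl ((idP P).sum (cobangP Q))) := by
    rw [Tape.mk_cast]; simp; rfl
  rw [h, functor_map_mk, interp_cast, interp, interp_idP, tensor, ← inl_nil_right, inl_desc_assoc]
  simp
  rfl

theorem functor_map_inr (P Q : Tape C) : M.functor.map (Tape.inr P Q) = M.inr P Q := by
  change M.tensor (M.interp (cobangP P)) (M.interp (idP Q)) = _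
  have := M.inr_desc (M.interp (cobangP P) ≫ M.inl P Q) (M.interp (idP Q) ≫ M.inr P Q)
  rw [interp_idP, Category.id_comp] at this
  rw [interp_idP, tensor, Category.id_comp]
  exact (Category.id_comp _).symm.trans this

/-- Convex combination in `T(C)` is `diag`, then a sum, then `codiag`. As `diag` is interpreted by
`inl +_p inr`, distributing the rest over it leaves the convex combination of the two arrows. -/
theorem functor_isPCAFunctor : IsPCAFunctor M.functor where
  map_star P Q := by
    change M.interp (bangP P) ≫ M.interp (cobangP Q) = _
    rw [interp_bangP, PCAEnriched.star_comp]
    rfl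
  map_conv {P Q} p f g := by
    obtain ⟨f, rfl⟩ := Tape.mk_surj f
    obtain ⟨g, rfl⟩ := Tape.mk_surj g
    change M.interp (diagP p P) ≫ M.tensor (M.interp f) (M.interp g) ≫ M.interp (codiagP Q) =
      PCA.conv p (M.interp f) (M.interp g)
    rw [interp_diagP, interp_codiagP, tensor, codiag, diag, PCAEnriched.conv_comp]
    simp

end WordModel

/-- A functor preserves finite coproducts if it preserves an initial object and the chosen binary
coproducts. -/
theorem preservesFiniteCoproducts_of_strictSums {C : Type u} [Category.{v} C] [StrictSums C]
    {D : Type u'} [Category.{w} D] {F : C ⥤ D}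
    (h₀ : Nonempty (IsInitial (F.obj StrictSums.zero)))
    (h : ∀ X Y : C, Nonempty (IsColimit (BinaryCofan.mk (F.map (StrictSums.inl X Y))
      (F.map (StrictSums.inr X Y))))) :
    PreservesFiniteCoproducts F := by
  obtain ⟨hC⟩ := StrictSums.zero_initial (C := C)
  have : HasInitial C := hC.hasInitial
  have : HasBinaryCoproducts C := by
    have : ∀ X Y : C, HasBinaryCoproduct X Y := fun X Y =>
      ⟨⟨⟨_, (StrictSums.sum_coproduct X Y).some⟩⟩⟩
    exact hasBinaryCoproducts_of_hasColimit_pair C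
  have : HasFiniteCoproducts C := hasFiniteCoproducts_of_has_binary_and_initial
  have : PreservesColimit (Functor.empty.{0} C) F := by
    apply preservesColimit_of_preserves_colimit_cocone hC
    exact (isColimitMapCoconeEmptyCoconeEquiv F _).symm h₀.some
  have : PreservesColimitsOfShape (Discrete.{0} PEmpty) F :=
    preservesColimitsOfShape_pempty_of_preservesInitial F
  have : PreservesColimitsOfShape (Discrete WalkingPair) F := by
    have : ∀ X Y : C, PreservesColimit (pair X Y) F := fun X Y =>
      preservesColimit_of_preserves_colimit_cocone (StrictSums.sum_coproduct X Y).some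
        ((isColimitMapCoconeBinaryCofanEquiv F _ _).symm (h X Y).some)
    exact ⟨fun {K} => preservesColimit_of_iso_diagram F (diagramIsoPair K).symm⟩
  exact ⟨fun n => PreservesFiniteCoproducts.of_preserves_binary_and_initial F (Fin n)⟩

namespace WordModel

variable {C : Type u} [Category.{v} C] {D : Type u'} [Category.{w} D] [PCAEnriched D]
  (M : WordModel C D)

theorem functor_isCBFunctor : isCBFunctor (Tape C) D M.functor := by
  refine ⟨M.functor_isPCAFunctor, preservesFiniteCoproducts_of_strictSums ?_ fun P Q => ?_⟩
  · exact ⟨IsInitial.ofUniqueHom (fun _ => PCA.star) fun _ _ => M.from_nil_ext _ _⟩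
  · change Nonempty (IsColimit (BinaryCofan.mk (M.functor.map (Tape.inl P Q))
      (M.functor.map (Tape.inr P Q))))
    rw [functor_map_inl, functor_map_inr]
    exact M.isColimit_append P Q

end WordModel

/-! ### Induction over the arrows of `T(C)` -/

namespace Tape

open TapeTerm hiding idP

variable {C : Type u} [Category.{v} C]

theorem hom_ext {P Q R : Tape C} {f g : P ++ Q ⟶ R} (h : inl P Q ≫ f = inl P Q ≫ g)
    (h' : inr P Q ≫ f = inr P Q ≫ g) : f = g :=
  BinaryCofan.IsColimit.hom_ext (sum_coproduct P Q).some h h'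

theorem from_nil_ext {P : Tape C} (f g : [] ⟶ P) : f = g := by
  have := cobang_nat f
  have := cobang_nat g
  rw [cobang_nil, Category.id_comp] at *
  simp_all

theorem to_nil_ext {P : Tape C} (f g : P ⟶ []) : f = g := by
  have h : bang ([] : Tape C) = 𝟙 [] := rfl
  rw [← Category.comp_id f, ← Category.comp_id g, ← h, bang_nat, bang_nat]

theorem diag_eq (p : OpenUnit) (P : Tape C) : diag p P = PCA.conv p (inl P P) (inr P P) := by
  change _ = diag p P ≫ tensor (inl P P) (inr P P) ≫ codiag (P ++ P)
  rw [copair_injections, Category.comp_id]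

/-- The structure terms of one-letter words differ from the generators by summands `idZero` and
identities. For explicit words the transport in `Rel.sum_zero` is trivial by definition, so the
axiom applies directly; the following lemmas use the same fact. -/
theorem mk_idObj (U : C) : mk (idObj U) = 𝟙 [U] := (mk_eq (Rel.sum_zero (idObj U))).symm

theorem mk_sym (U V : C) : mk (sym U V) = symm [U] [V] := by
  have h : Rel (((sym U V).sum idZero).comp ((idObj V).sum (idObj U))) (sym U V) :=
    .trans (.comp_congr (.sum_zero (sym U V)) (.sum_congr (.refl _) (.symm (.sum_zero (idObj U)))))
      (.comp_id _)
  have h' : Rel ((TapeTerm.idP [U, V]).comp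
      ((((sym U V).sum idZero).comp ((idObj V).sum (idObj U))).sum idZero)) (sym U V) :=
    .trans (.id_comp _) (.trans (.sum_zero (((sym U V).sum idZero).comp _)) h)
  exact (mk_eq h').symm

theorem mk_codiag (U : C) : mk (TapeTerm.codiag U) = codiag [U] := by
  have h : Rel ((TapeTerm.idP [U, U]).comp ((TapeTerm.codiag U).sum idZero))
      (TapeTerm.codiag U) :=
    .trans (.id_comp _) (.sum_zero (TapeTerm.codiag U))
  have h' : Rel ((idObj U).sum ((TapeTerm.idP [U]).sum idZero)) (TapeTerm.idP [U, U]) :=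
    .sum_congr (.refl _) (.sum_zero (TapeTerm.idP [U]))
  exact (mk_eq (.trans (.comp_congr h' (.refl _)) h)).symm

theorem mk_diag (p : OpenUnit) (U : C) : mk (TapeTerm.diag p U) = diag p [U] := by
  have h : Rel (((TapeTerm.diag p U).sum idZero).comp (TapeTerm.idP [U, U]))
      (TapeTerm.diag p U) :=
    .trans (.comp_id _) (.sum_zero (TapeTerm.diag p U))
  exact (mk_eq h).symm

theorem symm_nil_left (P : Tape C) : symm [] P = eqToHom (List.append_nil P).symm := by
  change mk (TapeTerm.cast _ _ _) = _
  rw [mk_cast]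
  exact (Category.id_comp _).trans (Category.id_comp _)

theorem inl_symm (P Q : Tape C) : inl P Q ≫ symm P Q = inr Q P := by
  rw [inl, inr, Category.assoc, symm_nat, symm_nil]
  simp

theorem inr_symm (P Q : Tape C) : inr P Q ≫ symm P Q = inl Q P := by
  rw [inl, inr, symm_nat, symm_nil_left]

/-- Every property of arrows that holds for the letters and is closed under the operations of a
`PCA`-enriched category with finite coproducts holds for all tapes. -/
theorem hom_induction {p : ∀ ⦃P Q : Tape C⦄, (P ⟶ Q) → Prop}
    (id : ∀ P : Tape C, p (𝟙 P))
    (comp : ∀ {P Q R : Tape C} (f : P ⟶ Q) (g : Q ⟶ R), p f → p g → p (f ≫ g))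
    (star : ∀ P Q : Tape C, p (PCA.star : P ⟶ Q))
    (conv : ∀ {P Q : Tape C} (r : OpenUnit) (f g : P ⟶ Q), p f → p g → p (PCA.conv r f g))
    (inl : ∀ P Q, p (inl P Q)) (inr : ∀ P Q, p (inr P Q))
    (copair : ∀ {P Q R : Tape C} (f : P ++ Q ⟶ R),
      p (Tape.inl P Q ≫ f) → p (Tape.inr P Q ≫ f) → p f)
    (letter : ∀ {U V : C} (c : U ⟶ V), p ((unit C).map c)) {P Q : Tape C} (f : P ⟶ Q) : p f := by
  obtain ⟨t, rfl⟩ := mk_surj f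
  induction t with
  | diag r U => rw [mk_diag, diag_eq]; exact conv _ _ _ (inl _ _) (inr _ _)
  | bang U => rw [to_nil_ext (mk _) PCA.star]; exact star _ _
  | tape c => exact letter c
  | cobang U => rw [from_nil_ext (mk _) PCA.star]; exact star _ _
  | codiag U =>
    rw [mk_codiag]
    refine copair (P := [U]) (Q := [U]) _ ?_ ?_
    · rw [inl_codiag]; exact id _
    · rw [inr_codiag]; exact id _
  | idObj U => rw [mk_idObj]; exact id _
  | idZero => exact id _
  | sym U V =>
    rw [mk_sym]
    refine copair (P := [U]) (Q := [V]) _ ?_ ?_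
    · rw [inl_symm]; exact inr _ _
    · rw [inr_symm]; exact inl _ _
  | comp t s ht hs => exact comp _ _ ht hs
  -- On the two summands `t ⊕ s` restricts to `t ; inl` and `s ; inr`, so copairing removes the need
  -- for a separate closure condition on sums.
  | sum t s ht hs =>
    refine copair _ ?_ ?_
    · rw [mk_sum, inl_tensor]; exact comp _ _ ht (inl _ _)
    · rw [mk_sum, inr_tensor]; exact comp _ _ hs (inr _ _)

end Tape

/-! ## Pointed convex algebras generated by a free family -/

namespace PCA

variable {X : Type u} {Y : Type v} [PCA Y]

/-- The subalgebra generated by the values of `g` on `S`. -/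
inductive Gen (g : X → Y) (S : Set X) : Y → Prop
  | star : Gen g S star
  | gen {x : X} (hx : x ∈ S) : Gen g S (g x)
  | conv (p : OpenUnit) {y z : Y} : Gen g S y → Gen g S z → Gen g S (conv p y z)

variable {g : X → Y}

theorem Gen.mono {S T : Set X} (h : S ⊆ T) {y : Y} (hy : Gen g S y) : Gen g T y := by
  induction hy with
  | star => exact .star
  | gen hx => exact .gen (h hx)
  | conv p _ _ ih ih' => exact .conv p ih ih'

theorem Gen.exists_finset {S : Set X} {y : Y} (hy : Gen g S y) :
    ∃ T : Finset X, Gen g (T : Set X) y := by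
  classical
  induction hy with
  | star => exact ⟨∅, .star⟩
  | @gen x hx => exact ⟨{x}, .gen (by simp)⟩
  | conv p _ _ ih ih' =>
    obtain ⟨T, hT⟩ := ih
    obtain ⟨T', hT'⟩ := ih'
    exact ⟨T ∪ T', .conv p (hT.mono (by simp)) (hT'.mono (by simp))⟩

theorem conv_conv_self (p q : OpenUnit) (x s : Y) :
    ∃ r, conv p x (conv q x s) = conv r x s := by
  obtain ⟨p, hp, hp'⟩ := p
  obtain ⟨q, hq, hq'⟩ := q
  -- The total weight of `x` is `p + (1 - p) q`, and `t` is the share of it that belongs to the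
  -- outer occurrence. Associativity for `r` and `t`, read backwards, collects both occurrences into
  -- `x +_t x = x`.
  have h : 0 < p + q - p * q := by nlinarith
  have h' : p + q - p * q < 1 := by nlinarith
  let r : OpenUnit := ⟨p + q - p * q, h, h'⟩
  let t : OpenUnit := ⟨p / (p + q - p * q), div_pos hp h, by rw [div_lt_one h]; nlinarith⟩
  refine ⟨r, ?_⟩
  have e : r.tildeP t = ⟨p, hp, hp'⟩ := Subtype.ext (mul_div_cancel₀ p h.ne')
  have e' : r.tildeQ t = ⟨q, hq, hq'⟩ := by
    apply Subtype.ext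
    change (p + q - p * q) * (1 - p / (p + q - p * q)) /
      (1 - (p + q - p * q) * (p / (p + q - p * q))) = q
    rw [mul_div_cancel₀ p h.ne', mul_sub, mul_div_cancel₀ p h.ne',
      div_eq_iff (by linarith)]
    ring
  have := conv_assoc r t x x s
  rwa [e, e', conv_idem, eq_comm] at this

theorem conv_left_comm (p q : OpenUnit) (s x t : Y) :
    ∃ r r', conv p s (conv q x t) = conv r x (conv r' t s) :=
  ⟨_, _, by rw [conv_comm, conv_assoc]⟩

/-- A normal form isolating one generator: all its occurrences are collected in front. The three
cases correspond to total weight one, zero, or strictly in between, and only the pca axioms are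
used. -/
theorem gen_insert_cases {x : X} {S : Set X} {y : Y} (hy : Gen g (insert x S) y) :
    y = g x ∨ Gen g S y ∨ ∃ p s, Gen g S s ∧ y = conv p (g x) s := by
  induction hy with
  | star => exact .inr (.inl .star)
  | gen hx =>
    obtain rfl | hx := hx
    · exact .inl rfl
    · exact .inr (.inl (.gen hx))
  | @conv p y z _ _ ih ih' =>
    have key : ∀ (p : OpenUnit) (z : Y),
        (z = g x ∨ Gen g S z ∨ ∃ q s, Gen g S s ∧ z = conv q (g x) s) →
        conv p (g x) z = g x ∨ Gen g S (conv p (g x) z) ∨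
          ∃ r s, Gen g S s ∧ conv p (g x) z = conv r (g x) s := by
      rintro p _ (rfl | hz | ⟨q, t, ht, rfl⟩)
      · exact .inl (conv_idem _ _)
      · exact .inr (.inr ⟨p, _, hz, rfl⟩)
      · obtain ⟨r, hr⟩ := conv_conv_self p q (g x) t
        exact .inr (.inr ⟨r, t, ht, hr⟩)
    have key' : ∀ (p : OpenUnit) (s z : Y), Gen g S s →
        (z = g x ∨ Gen g S z ∨ ∃ q s, Gen g S s ∧ z = conv q (g x) s) →
        Gen g S (conv p s z) ∨ ∃ r s', Gen g S s' ∧ conv p s z = conv r (g x) s' := by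
      rintro p s _ hs (rfl | hz | ⟨q, t, ht, rfl⟩)
      · exact .inr ⟨_, s, hs, conv_comm _ _ _⟩
      · exact .inl (.conv p hs hz)
      · obtain ⟨r, r', hr⟩ := conv_left_comm p q s (g x) t
        exact .inr ⟨r, _, .conv r' ht hs, hr⟩
    obtain rfl | hy | ⟨q, s, hs, rfl⟩ := ih
    · exact key p z ih'
    · exact .inr (key' p y z hy ih')
    -- Reassociation moves `g x` to the front; the remainder is a combination of `s` with `z`, which
    -- `key'` brings into the form that `key` expects.
    · rw [conv_assoc]
      exact key _ _ (.inr (key' _ s z hs ih'))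

theorem eq_star_of_gen_empty {y : Y} (hy : Gen g ∅ y) : y = star := by
  induction hy with
  | star => rfl
  | gen hx => exact hx.elim
  | conv p _ _ ih ih' => rw [ih, ih', conv_idem]

/-- An affine map that sends generators to linearly independent elements is injective. -/
theorem injective_of_gen {φ : Y → X →₀ ℝ} (h₀ : φ star = 0)
    (h : ∀ (p : OpenUnit) y z, φ (conv p y z) = p.1 • φ y + (1 - p.1) • φ z)
    (hg : ∀ x, φ (g x) = Finsupp.single x 1) (hY : ∀ y, Gen g Set.univ y) :
    Function.Injective φ := by
  classical
  -- Elements generated without `x` have no coordinate at `x`.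
  have supp {S : Set X} {x : X} (hx : x ∉ S) {y : Y} (hy : Gen g S y) : φ y x = 0 := by
    induction hy with
    | star => simp [h₀]
    | @gen x' hx' =>
      rw [hg, Finsupp.single_apply, if_neg]
      rintro rfl
      exact hx hx'
    | conv p _ _ ih ih' => simp [h, ih, ih']
  have key (S : Finset X) : ∀ y z, Gen g (S : Set X) y → Gen g (S : Set X) z → φ y = φ z →
      y = z := by
    induction S using Finset.induction_on with
    | empty =>
      intro y z hy hz _
      rw [Finset.coe_empty] at hy hz
      rw [eq_star_of_gen_empty hy, eq_star_of_gen_empty hz]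
    | insert x S hx ih =>
      intro y z hy hz hyz
      rw [Finset.coe_insert] at hy hz
      replace hx : x ∉ (S : Set X) := by simpa using hx
      have val (p : OpenUnit) {s : Y} (hs : Gen g (S : Set X) s) :
          φ (conv p (g x) s) x = p.1 := by
        simp [h, hg, supp hx hs]
      have val₁ : φ (g x) x = 1 := by simp [hg]
      -- In the three normal forms the coordinate at `x` is one, zero, or a weight in the open
      -- interval. Hence `y` and `z` have the same form, with the same weight in the mixed case.
      have hyz' := congrArg (· x) hyz
      obtain rfl | hy | ⟨p, s, hs, rfl⟩ := gen_insert_cases hy <;>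
      obtain rfl | hz | ⟨q, t, ht, rfl⟩ := gen_insert_cases hz
      · rfl
      · simp [val₁, supp hx hz] at hyz'
      · simp only [val₁, val q ht] at hyz'
        exact absurd hyz'.symm q.2.2.ne
      · simp [val₁, supp hx hy] at hyz'
      · exact ih y z hy hz hyz
      · simp only [supp hx hy, val q ht] at hyz'
        exact absurd hyz' q.2.1.ne
      · simp only [val₁, val p hs] at hyz'
        exact absurd hyz' p.2.2.ne
      · simp only [supp hx hz, val p hs] at hyz'
        exact absurd hyz'.symm p.2.1.ne
      · simp only [val p hs, val q ht] at hyz'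
        obtain rfl : p = q := Subtype.ext hyz'
        -- The vector space allows the cancellation that an abstract pca does not: the common
        -- multiple of `φ (g x)` drops out, `1 - p` is divided out, and the remainders agree by
        -- induction.
        rw [h, h, add_right_inj] at hyz
        have hp : 1 - p.1 ≠ 0 := by have := p.2.2; linarith
        rw [ih s t hs ht (smul_right_injective _ hp hyz)]
  intro y z hyz
  obtain ⟨S, hS⟩ := (hY y).exists_finset
  obtain ⟨T, hT⟩ := (hY z).exists_finset
  exact key (S ∪ T) y z (hS.mono (by simp)) (hT.mono (by simp)) hyz

end PCA

/-! ## Linear categories are enriched in pointed convex algebras -/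

/-- The convex structure of a real vector space. -/
@[reducible]
def PCA.ofModule (V : Type u) [AddCommGroup V] [Module ℝ V] : PCA V where
  star := 0
  conv p x y := p.1 • x + (1 - p.1) • y
  conv_assoc p q x y z := by
    have h : 1 - p.1 * q.1 ≠ 0 := by
      nlinarith [p.2.1, p.2.2, q.2.1, q.2.2]
    have e₁ : (1 - p.1 * q.1) * (p.tildeQ q).1 = p.1 * (1 - q.1) := mul_div_cancel₀ _ h
    have e₂ : (1 - p.1 * q.1) * (1 - (p.tildeQ q).1) = 1 - p.1 := by
      rw [mul_sub, e₁]; ring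
    change _ = (p.1 * q.1) • x + (1 - p.1 * q.1) • _
    rw [smul_add (1 - p.1 * q.1), smul_smul, smul_smul, e₁, e₂]
    module
  conv_comm p x y := by
    change _ = (1 - p.1) • y + (1 - (1 - p.1)) • x
    module
  conv_idem p x := by module

/-- Real linear categories are `PCA`-enriched. -/
@[reducible]
def PCAEnriched.ofLinear (C : Type u) [Category.{v} C] [Preadditive C] [Linear ℝ C] :
    PCAEnriched C where
  pca X Y := PCA.ofModule (X ⟶ Y)
  comp_conv p e f g := by simp [PCA.conv]
  conv_comp p f g h := by simp [PCA.conv]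
  comp_star f := comp_zero
  star_comp f := zero_comp

/-! ## Arrows out of a letter -/

namespace Tape

variable {C : Type u} [Category.{v} C]

/-- The arrows of `C` from `U` to a letter of a word. -/
def Entry (U : C) : List C → Type v
  | [] => PEmpty
  | V :: P => (U ⟶ V) ⊕ Entry U P

/-- The entry given by an arrow to the first letter. -/
def Entry.here {U V : C} {P : List C} (c : U ⟶ V) : Entry U (V :: P) := Sum.inl c

/-- The entry given by an entry of the remaining letters. -/
def Entry.there {U V : C} {P : List C} (x : Entry U P) : Entry U (V :: P) := Sum.inr x

theorem Entry.cons_cases {U V : C} {P : List C} (x : Entry U (V :: P)) :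
    (∃ c, x = here c) ∨ ∃ y, x = there y := by
  obtain c | y := x
  · exact .inl ⟨c, rfl⟩
  · exact .inr ⟨y, rfl⟩

theorem Entry.singleton_cases {U V : C} (x : Entry U [V]) : ∃ c, x = here c := by
  obtain h | ⟨y, _⟩ := x.cons_cases
  · exact h
  · exact y.elim

/-- Applying a function to an entry of a one-letter word. -/
def Entry.mapHead {U V W : C} {P : List C} (f : (U ⟶ V) → (U ⟶ W)) :
    Entry U [V] → Entry U (W :: P) :=
  Sum.elim (fun c => here (f c)) PEmpty.elim

/-- The arrow of `T(C)` represented by an arrow of `C`. -/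
def letter {U V : C} (c : U ⟶ V) : ([U] : Tape C) ⟶ [V] := (unit C).map c

theorem letter_id (U : C) : letter (𝟙 U) = 𝟙 [U] := (unit C).map_id U

theorem letter_comp {U V W : C} (c : U ⟶ V) (d : V ⟶ W) :
    letter (c ≫ d) = letter c ≫ letter d := (unit C).map_comp c d

/-- The arrow of `T(C)` given by an arrow to a letter. -/
def ofEntry {U : C} : {P : List C} → Entry U P → (([U] : Tape C) ⟶ P)
  | [], x => PEmpty.elim x
  | V :: P, .inl c => letter c ≫ inl [V] P
  | V :: P, .inr x => ofEntry x ≫ inr [V] P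

theorem ofEntry_here {U V : C} (P : Tape C) (c : U ⟶ V) :
    ofEntry (.here c) = letter c ≫ inl [V] P := rfl

theorem ofEntry_there {U V : C} {P : Tape C} (x : Entry U P) :
    ofEntry (.there x) = ofEntry x ≫ inr [V] P := rfl

theorem inl_singleton_nil (V : C) : inl ([V] : Tape C) [] = 𝟙 _ :=
  StrictSums.inl_zero (C := Tape C) [V]

theorem inr_nil (P : Tape C) : inr [] P = 𝟙 _ := StrictSums.inr_zero (C := Tape C) P

theorem inl_cons (V : C) (P Q : Tape C) :
    inl [V] P ≫ inl (V :: P) Q = inl [V] (P ++ Q) := by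
  have := inl_comp_inl [V] P Q
  exact ((congrArg (inl [V] P ≫ ·) (Category.comp_id _)).symm).trans this

theorem inr_singleton_inl (V : C) (P Q : Tape C) :
    inr [V] P ≫ inl (V :: P) Q = inl P Q ≫ inr [V] (P ++ Q) := by
  have := inr_comp_inl [V] P Q
  exact ((congrArg (inr [V] P ≫ ·) (Category.comp_id _)).symm).trans this

theorem inr_cons (V : C) (P Q : Tape C) :
    inr (V :: P) Q = inr P Q ≫ inr [V] (P ++ Q) := by
  have := inr_comp_inr [V] P Q
  exact (Category.comp_id _).symm.trans this

/-- An entry points to a single letter, which lies in one of the two words. This is what makes the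
copairing case of `gen_ofEntry_comp` work. -/
theorem ofEntry_append {U : C} {P Q : Tape C} (x : Entry U (P ++ Q)) :
    (∃ y : Entry U P, ofEntry x = ofEntry y ≫ inl P Q) ∨
      ∃ y : Entry U Q, ofEntry x = ofEntry y ≫ inr P Q := by
  induction P with
  | nil => exact .inr ⟨x, by rw [inr_nil]; exact (Category.comp_id _).symm⟩
  | cons V P ih =>
    obtain ⟨c, hx⟩ | ⟨x', hx⟩ := Entry.cons_cases (P := P ++ Q) x
    · refine .inl ⟨.here c, ?_⟩
      rw [ofEntry_here, Category.assoc, inl_cons, hx]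
      rfl
    · have e : ofEntry x = ofEntry x' ≫ inr [V] (P ++ Q) := congrArg ofEntry hx
      obtain ⟨y, hy⟩ | ⟨y, hy⟩ := ih x'
      · refine .inl ⟨.there y, e.trans ?_⟩
        rw [ofEntry_there, Category.assoc, inr_singleton_inl, hy, Category.assoc]
      · refine .inr ⟨y, e.trans ?_⟩
        rw [inr_cons V P Q, hy, Category.assoc]

theorem gen_comp {U : C} {P Q : Tape C} {f : P ⟶ Q}
    (h : ∀ x : Entry U P, PCA.Gen ofEntry Set.univ (ofEntry x ≫ f)) {e : ([U] : Tape C) ⟶ P}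
    (he : PCA.Gen (ofEntry (U := U)) Set.univ e) :
    PCA.Gen (ofEntry (U := U)) Set.univ (e ≫ f) := by
  induction he with
  | star => rw [PCAEnriched.star_comp]; exact .star
  | gen _ => exact h _
  | conv p _ _ ih ih' => rw [PCAEnriched.conv_comp]; exact .conv p ih ih'

theorem gen_ofEntry_inr {U : C} (P : Tape C) {Q : Tape C} (x : Entry U Q) :
    PCA.Gen ofEntry Set.univ (ofEntry x ≫ inr P Q) := by
  induction P with
  | nil =>
    rw [inr_nil]
    exact (Category.comp_id (ofEntry x)).symm ▸ .gen (Set.mem_univ x)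
  | cons V P ih =>
    rw [inr_cons, ← Category.assoc]
    exact gen_comp (fun y => .gen (Set.mem_univ (Entry.there y : Entry U (V :: (P ++ Q))))) ih

theorem gen_ofEntry_inl {U : C} {P : Tape C} (Q : Tape C) (x : Entry U P) :
    PCA.Gen ofEntry Set.univ (ofEntry x ≫ inl P Q) := by
  induction P with
  | nil => exact x.elim
  | cons V P ih =>
    obtain ⟨c, rfl⟩ | ⟨x, rfl⟩ := x.cons_cases
    · rw [ofEntry_here, Category.assoc, inl_cons]
      exact .gen (Set.mem_univ (Entry.here c : Entry U (V :: (P ++ Q))))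
    · rw [ofEntry_there, Category.assoc, inr_singleton_inl, ← Category.assoc]
      exact gen_comp (fun y => .gen (Set.mem_univ (Entry.there y : Entry U (V :: (P ++ Q))))) (ih x)

/-- Instead of generation of a single hom-set, the induction carries the statement that
postcomposition with `f` keeps entries inside the generated subalgebra. Postcomposition is affine,
so this property is stable under composition; the case of an arrow out of a letter is recovered from
the identity entry. -/
theorem gen_ofEntry_comp {P Q : Tape C} (f : P ⟶ Q) :
    ∀ (U : C) (x : Entry U P), PCA.Gen ofEntry Set.univ (ofEntry x ≫ f) := by
  refine hom_induction (p := fun P Q f =>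
    ∀ (U : C) (x : Entry U P), PCA.Gen ofEntry Set.univ (ofEntry x ≫ f))
    ?_ ?_ ?_ ?_ ?_ ?_ ?_ ?_ f
  · intro P U x
    rw [Category.comp_id]
    exact .gen (Set.mem_univ _)
  · intro P Q R f g hf hg U x
    rw [← Category.assoc]
    exact gen_comp (hg U) (hf U x)
  · intro P Q U x
    rw [PCAEnriched.comp_star]
    exact .star
  · intro P Q r f g hf hg U x
    rw [PCAEnriched.comp_conv]
    exact .conv r (hf U x) (hg U x)
  · exact fun P Q U x => gen_ofEntry_inl Q x
  · exact fun P Q U x => gen_ofEntry_inr P x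
  · intro P Q R f hf hf' U x
    obtain ⟨y, hy⟩ | ⟨y, hy⟩ := ofEntry_append x
    · rw [hy, Category.assoc]; exact hf U y
    · rw [hy, Category.assoc]; exact hf' U y
  · intro V W c U x
    obtain ⟨d, rfl⟩ := x.singleton_cases
    have h : ofEntry (.here d) ≫ letter c = ofEntry (.here (d ≫ c)) := by
      rw [ofEntry_here, ofEntry_here, inl_singleton_nil, inl_singleton_nil, letter_comp]
      simp
    exact h ▸ .gen (Set.mem_univ _)

/-- The identity as an entry. -/
def idEntry (U : C) : Entry U [U] := .here (𝟙 U)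

theorem ofEntry_idEntry (U : C) : ofEntry (idEntry U) = 𝟙 [U] := by
  rw [idEntry, ofEntry_here, inl_singleton_nil, letter_id]
  exact Category.comp_id _

theorem gen_ofEntry {U : C} {P : Tape C} (f : ([U] : Tape C) ⟶ P) :
    PCA.Gen ofEntry Set.univ f := by
  have := gen_ofEntry_comp f U (idEntry U)
  rwa [ofEntry_idEntry, Category.id_comp] at this

/-! ### Freeness of the hom-sets out of a letter, via real vector spaces -/

noncomputable instance : PCAEnriched (ModuleCat.{v} ℝ) := .ofLinear _

/-- The free vector space on a disjoint union is the coproduct of the free vector spaces, since a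
linear map is prescribed freely on a basis. -/
theorem isColimit_finsupp {X Y Z : Type v} (f : X → Z) (g : Y → Z)
    (h : Function.Bijective (Sum.elim f g)) :
    Nonempty (IsColimit (BinaryCofan.mk (ModuleCat.ofHom (Finsupp.lmapDomain ℝ ℝ f))
      (ModuleCat.ofHom (Finsupp.lmapDomain ℝ ℝ g)))) := by
  let e := Equiv.ofBijective _ h
  have he (x) : e.symm (f x) = .inl x := e.symm_apply_eq.2 rfl
  have he' (y) : e.symm (g y) = .inr y := e.symm_apply_eq.2 rfl
  refine ⟨BinaryCofan.isColimitMk (fun s => ModuleCat.ofHom (Finsupp.linearCombination ℝ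
    (fun z => Sum.elim (fun x => s.inl.hom (Finsupp.single x 1))
      (fun y => s.inr.hom (Finsupp.single y 1)) (e.symm z)))) ?_ ?_ ?_⟩
  · intro s
    ext x
    simp [he]
    rfl
  · intro s
    ext x
    simp [he']
    rfl
  · intro s m h₁ h₂
    ext z
    obtain ⟨x | y, rfl⟩ := e.surjective z
    · have := congrArg (fun k => k.hom (Finsupp.single x 1)) h₁
      simp only [Equiv.symm_apply_apply, ModuleCat.hom_ofHom, LinearMap.comp_apply,
        Finsupp.lsingle_apply, Finsupp.linearCombination_single, one_smul, Sum.elim_inl]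
      exact (congrArg m.hom (Finsupp.mapDomain_single (f := f)).symm).trans this
    · have := congrArg (fun k => k.hom (Finsupp.single y 1)) h₂
      simp only [Equiv.symm_apply_apply, ModuleCat.hom_ofHom, LinearMap.comp_apply,
        Finsupp.lsingle_apply, Finsupp.linearCombination_single, one_smul, Sum.elim_inr]
      exact (congrArg m.hom (Finsupp.mapDomain_single (f := g)).symm).trans this

theorem ofHom_lmapDomain_id {X : Type v} {f : X → X} (h : ∀ x, f x = x) :
    ModuleCat.ofHom (Finsupp.lmapDomain ℝ ℝ f) = 𝟙 (ModuleCat.of ℝ (X →₀ ℝ)) := by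
  obtain rfl : f = id := funext h
  rw [Finsupp.lmapDomain_id]
  rfl

theorem ofHom_lmapDomain_comp {X Y Z : Type v} {f : X → Y} {g : Y → Z} {k : X → Z}
    (h : ∀ x, k x = g (f x)) : ModuleCat.ofHom (Finsupp.lmapDomain ℝ ℝ k) =
      ModuleCat.ofHom (Finsupp.lmapDomain ℝ ℝ f) ≫
        ModuleCat.ofHom (Finsupp.lmapDomain ℝ ℝ g) := by
  obtain rfl : k = g ∘ f := funext h
  rw [Finsupp.lmapDomain_comp]
  rfl

/-- The interpretation of words as free vector spaces on their entries. -/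
noncomputable def entryModel (U : C) : WordModel C (ModuleCat.{v} ℝ) where
  obj P := ModuleCat.of ℝ (Entry U P →₀ ℝ)
  head V P := ModuleCat.ofHom (Finsupp.lmapDomain ℝ ℝ (Entry.mapHead id))
  tail V P := ModuleCat.ofHom (Finsupp.lmapDomain ℝ ℝ Entry.there)
  head_nil V := by
    refine ofHom_lmapDomain_id fun x => ?_
    obtain ⟨c, rfl⟩ := x.singleton_cases
    rfl
  id_nil := by
    ext x
    exact x.elim
  cons_coproduct V P := by
    refine isColimit_finsupp _ _ ⟨?_, ?_⟩
    · rintro (x | x) (y | y) h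
      · obtain ⟨c, rfl⟩ := x.singleton_cases
        obtain ⟨d, rfl⟩ := y.singleton_cases
        obtain rfl : c = d := Sum.inl.inj h
        rfl
      · obtain ⟨c, rfl⟩ := x.singleton_cases
        exact (Sum.inl_ne_inr h).elim
      · obtain ⟨d, rfl⟩ := y.singleton_cases
        exact (Sum.inr_ne_inl h).elim
      · exact congrArg Sum.inr (Sum.inr.inj h)
    · intro x
      obtain ⟨c, rfl⟩ | ⟨x, rfl⟩ := x.cons_cases
      · exact ⟨.inl (.here c), rfl⟩
      · exact ⟨.inr x, rfl⟩
  gen c := ModuleCat.ofHom (Finsupp.lmapDomain ℝ ℝ (Entry.mapHead (· ≫ c)))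
  gen_id V := by
    refine ofHom_lmapDomain_id fun x => ?_
    obtain ⟨c, rfl⟩ := x.singleton_cases
    exact congrArg Entry.here (Category.comp_id c)
  gen_comp c d := by
    refine ofHom_lmapDomain_comp fun x => ?_
    obtain ⟨e, rfl⟩ := x.singleton_cases
    exact congrArg Entry.here (Category.assoc e c d).symm

/-- The weights of the entries in an arrow out of a letter. -/
noncomputable def weights {U : C} {P : Tape C} (f : ([U] : Tape C) ⟶ P) : Entry U P →₀ ℝ :=
  ((entryModel U).functor.map f).hom (Finsupp.single (idEntry U) (1 : ℝ) : Entry U [U] →₀ ℝ)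

theorem weights_comp {U : C} {P Q : Tape C} (f : ([U] : Tape C) ⟶ P) (g : P ⟶ Q) :
    weights (f ≫ g) = ((entryModel U).functor.map g).hom (weights f) := by
  rw [weights, Functor.map_comp]
  rfl

/-- The linear interpretation lets arrows act on entries by composition, so evaluation at the
identity entry returns the entry itself. This is the linear independence of the generators. -/
theorem weights_ofEntry {U : C} {P : Tape C} (x : Entry U P) :
    weights (ofEntry x) = Finsupp.single x 1 := by
  induction P with
  | nil => exact x.elim
  | cons V P ih =>
    obtain ⟨c, rfl⟩ | ⟨x, rfl⟩ := x.cons_cases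
    · rw [ofEntry_here, weights_comp, WordModel.functor_map_inl, WordModel.inl_singleton]
      have : weights (letter c) = Finsupp.single (.here c) (1 : ℝ) :=
        Finsupp.mapDomain_single.trans
          (congrArg (Finsupp.single · _) (congrArg Entry.here (Category.id_comp c)))
      rw [this]
      exact Finsupp.mapDomain_single
    · rw [ofEntry_there, weights_comp, ih, WordModel.functor_map_inr, WordModel.inr_singleton]
      exact Finsupp.mapDomain_single

theorem weights_conv {U : C} {P : Tape C} (p : OpenUnit) (f g : ([U] : Tape C) ⟶ P) :
    weights (PCA.conv p f g) = p.1 • weights f + (1 - p.1) • weights g := by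
  rw [weights, (entryModel U).functor_isPCAFunctor.map_conv]
  rfl

/-- Entries generate the hom-set and become basis vectors, so no relations hold beyond the pca
axioms. Cancellation and smallness are then read off from the vector space of weights. -/
theorem weights_injective {U : C} {P : Tape C} :
    Function.Injective (weights : (([U] : Tape C) ⟶ P) → _) := by
  refine PCA.injective_of_gen ?_ weights_conv weights_ofEntry gen_ofEntry
  rw [weights, (entryModel U).functor_isPCAFunctor.map_star]
  rfl

theorem hom_ext_letters {P Q : Tape C} {f g : P ⟶ Q}
    (h : ∀ (U : C) (x : Entry U P), ofEntry x ≫ f = ofEntry x ≫ g) : f = g := by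
  induction P with
  | nil => exact from_nil_ext f g
  | cons U P ih =>
    refine hom_ext (P := [U]) (Q := P) ?_ (ih fun V x => ?_)
    · have := h U (.here (𝟙 U))
      rw [ofEntry_here, letter_id] at this
      simpa using this
    · have := h V (.there x)
      rw [ofEntry_there] at this
      simpa using this

theorem conv_star_injective (p : OpenUnit) {P Q : Tape C} {f g : P ⟶ Q}
    (h : PCA.conv p f PCA.star = PCA.conv p g PCA.star) : f = g := by
  refine hom_ext_letters fun U x => weights_injective ?_
  have e : weights (PCA.conv p (ofEntry x ≫ f) PCA.star) =
      weights (PCA.conv p (ofEntry x ≫ g) PCA.star) := by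
    have := congrArg (ofEntry x ≫ ·) h
    simpa only [PCAEnriched.comp_conv, PCAEnriched.comp_star] using congrArg weights this
  rw [weights_conv, weights_conv, add_left_inj] at e
  exact smul_right_injective _ p.2.1.ne' e

/-- Classes of terms live in the universe `max u v`, because terms mention intermediate objects.
Weights only involve arrows of `C`, so they live in `v`. -/
instance small_hom_letter (U : C) (P : Tape C) : Small.{v} (([U] : Tape C) ⟶ P) :=
  small_of_injective weights_injective

theorem locallySmall : LocallySmall.{v} (Tape C) where
  hom_small P Q := by
    induction P with
    | nil =>
      have : Subsingleton (([] : Tape C) ⟶ Q) := ⟨from_nil_ext⟩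
      infer_instance
    | cons U P ih =>
      have : Function.Injective fun f : ((U :: P : Tape C) ⟶ Q) =>
          ((inl [U] P ≫ f : ([U] : Tape C) ⟶ Q), (inr [U] P ≫ f : P ⟶ Q)) :=
        fun f g h => hom_ext (P := [U]) (Q := P) (congrArg Prod.fst h) (congrArg Prod.snd h)
      exact small_of_injective this

end Tape

/-! ## Convex biproducts of tapes -/

namespace PCA

variable {X : Type u} [PCA X]

theorem smul_of_mem {p : ℝ} (h : p ∈ Set.Ioo (0 : ℝ) 1) (x : X) :
    smul p x = conv ⟨p, h⟩ x star := dif_pos h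

theorem smul_zero (x : X) : smul 0 x = star := by
  simp [smul]

theorem smul_one (x : X) : smul 1 x = x := by
  simp [smul]

theorem smul_star (p : ℝ) : smul p (star : X) = star := by
  unfold smul
  split_ifs <;> simp [conv_idem]

theorem conv_star_smul (p q : OpenUnit) (x : X) :
    conv p star (conv q x star) = conv (p.compl.tildeP q) x star := by
  rw [conv_comm, conv_assoc, conv_idem]

end PCA

namespace PCAEnriched

variable {C : Type u} [Category.{v} C] [PCAEnriched C]

theorem smul_comp {X Y Z : C} (p : ℝ) (f : X ⟶ Y) (g : Y ⟶ Z) :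
    PCA.smul p f ≫ g = PCA.smul p (f ≫ g) := by
  unfold PCA.smul
  split_ifs <;> simp [conv_comp, star_comp]

/-- Weighted pairings along a pair of injections with orthogonal retractions. -/
theorem exists_convexPair {A X Y S : C} {ι₁ : X ⟶ S} {ι₂ : Y ⟶ S} {π₁ : S ⟶ X} {π₂ : S ⟶ Y}
    (h₁₁ : ι₁ ≫ π₁ = 𝟙 X) (h₁₂ : ι₁ ≫ π₂ = PCA.star) (h₂₁ : ι₂ ≫ π₁ = PCA.star)
    (h₂₂ : ι₂ ≫ π₂ = 𝟙 Y) {p₁ p₂ : ℝ} (hp₁ : 0 ≤ p₁) (hp₂ : 0 ≤ p₂) (hp : p₁ + p₂ ≤ 1)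
    (f : A ⟶ X) (g : A ⟶ Y) :
    ∃ h : A ⟶ S, h ≫ π₁ = PCA.smul p₁ f ∧ h ≫ π₂ = PCA.smul p₂ g := by
  -- Convex combinations exist only for weights in the open interval, so vanishing weights are
  -- treated apart.
  obtain rfl | hp₁ := hp₁.eq_or_lt
  · refine ⟨PCA.smul p₂ (g ≫ ι₂), ?_, ?_⟩
    · rw [smul_comp, Category.assoc, h₂₁, comp_star, PCA.smul_star, PCA.smul_zero]
    · rw [smul_comp, Category.assoc, h₂₂, Category.comp_id]
  obtain rfl | hp₂ := hp₂.eq_or_lt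
  · refine ⟨PCA.smul p₁ (f ≫ ι₁), ?_, ?_⟩
    · rw [smul_comp, Category.assoc, h₁₁, Category.comp_id]
    · rw [smul_comp, Category.assoc, h₁₂, comp_star, PCA.smul_star, PCA.smul_zero]
  have hp₁' : p₁ < 1 := by linarith
  have hp₂' : p₂ < 1 := by linarith
  let p : OpenUnit := ⟨p₁, hp₁, hp₁'⟩
  -- The outer combination scales its second argument by `1 - p₁`, so the inner weight is `p₂ / (1 -
  -- p₁)`. It is at most one because `p₁ + p₂ ≤ 1`, with equality exactly when the weights sum to
  -- one.
  refine ⟨PCA.conv p (f ≫ ι₁) (PCA.smul (p₂ / (1 - p₁)) (g ≫ ι₂)), ?_, ?_⟩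
  · rw [conv_comp, smul_comp, Category.assoc, Category.assoc, h₁₁, h₂₁, Category.comp_id, comp_star,
      PCA.smul_star, PCA.smul_of_mem ⟨hp₁, hp₁'⟩]
  · rw [conv_comp, smul_comp, Category.assoc, Category.assoc, h₁₂, h₂₂, Category.comp_id, comp_star,
      PCA.smul_of_mem ⟨hp₂, hp₂'⟩]
    obtain hp | hp := hp.eq_or_lt
    · obtain rfl : p₂ = 1 - p₁ := by linarith
      rw [div_self hp₂.ne', PCA.smul_one, PCA.conv_comm]
      rfl
    · have hq : p₂ / (1 - p₁) ∈ Set.Ioo (0 : ℝ) 1 :=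
        ⟨div_pos hp₂ (by linarith), by rw [div_lt_one (by linarith)]; linarith⟩
      rw [PCA.smul_of_mem hq, PCA.conv_star_smul]
      congr 1
      exact Subtype.ext (mul_div_cancel₀ p₂ (by linarith : (1 - p₁) ≠ 0))

end PCAEnriched

/-! ### `T(C)` is a convex biproduct category -/

namespace Tape

variable {C : Type u} [Category.{v} C]

theorem exists_projections (P Q : Tape C) : ∃ (π₁ : P ++ Q ⟶ P) (π₂ : P ++ Q ⟶ Q),
    inl P Q ≫ π₁ = 𝟙 P ∧ inl P Q ≫ π₂ = PCA.star ∧ inr P Q ≫ π₁ = PCA.star ∧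
      inr P Q ≫ π₂ = 𝟙 Q := by
  obtain ⟨π₁, h₁, h₁'⟩ := BinaryCofan.IsColimit.desc' (sum_coproduct P Q).some (𝟙 P) PCA.star
  obtain ⟨π₂, h₂, h₂'⟩ := BinaryCofan.IsColimit.desc' (sum_coproduct P Q).some PCA.star (𝟙 Q)
  exact ⟨π₁, π₂, h₁, h₂, h₁', h₂'⟩

/-- Existence of weighted pairings needs only the enrichment and the orthogonal projections.
Uniqueness rests on `conv_star_injective`, and hence on freeness. -/
theorem convexBiproductCategory : ConvexBiproductCategory (Tape C) where
  exists_zero := ⟨[], StrictSums.zero_initial (C := Tape C),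
    ⟨IsTerminal.ofUniqueHom bang fun _ _ => to_nil_ext _ _⟩⟩
  exists_biproduct P Q := by
    obtain ⟨π₁, π₂, h₁₁, h₁₂, h₂₁, h₂₂⟩ := exists_projections P Q
    refine ⟨P ++ Q, inl P Q, inr P Q, π₁, π₂, sum_coproduct P Q, ?_, h₁₁, h₁₂, h₂₁, h₂₂⟩
    intro p₁ p₂ hp₁ hp₂ hp A f g
    obtain ⟨h, hh⟩ := PCAEnriched.exists_convexPair h₁₁ h₁₂ h₂₁ h₂₂ hp₁ hp₂ hp f g
    refine ⟨h, hh, fun k hk => ?_⟩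
    -- With weight one half both injections are scaled alike, so the combination of `π₁ ; ι₁` and
    -- `π₂ ; ι₂` is the half of the identity. Thus the half of an arrow is a function of its two
    -- projections.
    let r : OpenUnit := ⟨1 / 2, by norm_num, by norm_num⟩
    have hr : r.compl = r := Subtype.ext (by norm_num [r, OpenUnit.compl])
    have e : PCA.conv r (π₁ ≫ inl P Q) (π₂ ≫ inr P Q) = PCA.conv r (𝟙 _) PCA.star := by
      refine hom_ext ?_ ?_
      · simp only [PCAEnriched.comp_conv, reassoc_of% h₁₁, reassoc_of% h₁₂, PCAEnriched.comp_star,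
          PCAEnriched.star_comp, Category.comp_id]
      · simp only [PCAEnriched.comp_conv, reassoc_of% h₂₁, reassoc_of% h₂₂, PCAEnriched.comp_star,
          PCAEnriched.star_comp, Category.comp_id]
        rw [PCA.conv_comm, hr]
    have e' (m : A ⟶ P ++ Q) : PCA.conv r m PCA.star =
        PCA.conv r ((m ≫ π₁) ≫ inl P Q) ((m ≫ π₂) ≫ inr P Q) := by
      have := congrArg (m ≫ ·) e
      simp only [PCAEnriched.comp_conv, PCAEnriched.comp_star, Category.comp_id] at this
      rw [← this, Category.assoc, Category.assoc]
    refine conv_star_injective r ?_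
    rw [e', e', hk.1, hk.2, hh.1, hh.2]

end Tape

/-! ## Extension of functors to tapes -/

/-- A choice of a zero object and of binary coproducts. -/
structure SumChoice (D : Type u') [Category.{w} D] [PCAEnriched D] where
  zero : D
  sum : D → D → D
  inl : ∀ X Y : D, X ⟶ sum X Y
  inr : ∀ X Y : D, Y ⟶ sum X Y
  id_zero : 𝟙 zero = PCA.star
  sum_coproduct : ∀ X Y : D, Nonempty (IsColimit (BinaryCofan.mk (inl X Y) (inr X Y)))

namespace SumChoice

variable {C : Type u} [Category.{v} C] {D : Type u'} [Category.{w} D] [PCAEnriched D]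

theorem exists_of_convexBiproductCategory [ConvexBiproductCategory D] :
    Nonempty (SumChoice D) := by
  obtain ⟨Z, ⟨hZ⟩, -⟩ := ConvexBiproductCategory.exists_zero (C := D)
  choose S i₁ i₂ _ _ h using ConvexBiproductCategory.exists_biproduct (C := D)
  exact ⟨⟨Z, S, i₁, i₂, hZ.hom_ext _ _, fun X Y => (h X Y).1⟩⟩

/-- The choice given by strict coproducts. -/
def ofStrictSums [StrictSums D] : SumChoice D where
  zero := StrictSums.zero
  sum := StrictSums.sum
  inl := StrictSums.inl
  inr := StrictSums.inr
  id_zero := StrictSums.zero_initial.some.hom_ext _ _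
  sum_coproduct := StrictSums.sum_coproduct

variable (S : SumChoice D) (F : C ⥤ D)

/-- The sum of the values of a functor at the letters of a word. -/
def wordObj : List C → D
  | [] => S.zero
  -- A single letter goes to `F.obj U` itself and not to its sum with zero. This makes the extension
  -- agree with `F` on the nose in every target, strict or not.
  | [U] => F.obj U
  | U :: V :: P => S.sum (F.obj U) (wordObj (V :: P))

/-- The interpretation that extends a functor. -/
def wordModel : WordModel C D where
  obj := S.wordObj F
  head U
    | [] => 𝟙 (F.obj U)
    | V :: P => S.inl (F.obj U) (S.wordObj F (V :: P))
  tail U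
    | [] => PCA.star
    | V :: P => S.inr (F.obj U) (S.wordObj F (V :: P))
  head_nil _ := rfl
  id_nil := S.id_zero
  cons_coproduct U
    -- Since `zero` is a zero object, `F.obj U` is a coproduct of itself and `zero`.
    | [] => ⟨BinaryCofan.isColimitMk (fun s => s.inl) (fun s => Category.id_comp _)
        (fun s => (by
          have h (f : S.zero ⟶ s.pt) : f = PCA.star := by
            rw [← Category.id_comp f, S.id_zero, PCAEnriched.star_comp]
          exact (h _).trans (h _).symm)) (fun s m h _ => (Category.id_comp m).symm.trans h)⟩
    | V :: P => S.sum_coproduct _ _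
  gen c := F.map c
  gen_id _ := F.map_id _
  gen_comp _ _ := F.map_comp _ _

/-- The extension of a functor to tapes. -/
noncomputable def lift : Tape C ⥤ D := (S.wordModel F).functor

theorem unit_comp_lift : Tape.unit C ⋙ S.lift F = F := rfl

end SumChoice

/-! ## Natural transformations between functors on tapes -/

namespace Tape

variable {C : Type u} [Category.{v} C] {D : Type u'} [Category.{w} D]

section Preserves

variable (H : Tape C ⥤ D) [PreservesFiniteCoproducts H]

theorem map_from_nil_ext {X : D} (f g : H.obj [] ⟶ X) : f = g :=
  (IsInitial.isInitialObj H _ (StrictSums.zero_initial (C := Tape C)).some).hom_ext f g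

theorem isColimit_map (P Q : Tape C) :
    Nonempty (IsColimit (BinaryCofan.mk (H.map (inl P Q)) (H.map (inr P Q)))) :=
  ⟨isColimitMapCoconeBinaryCofanEquiv H _ _ (isColimitOfPreserves H (sum_coproduct P Q).some)⟩

theorem map_hom_ext {P Q : Tape C} {X : D} {f g : H.obj (P ++ Q) ⟶ X}
    (h : H.map (inl P Q) ≫ f = H.map (inl P Q) ≫ g)
    (h' : H.map (inr P Q) ≫ f = H.map (inr P Q) ≫ g) : f = g :=
  BinaryCofan.IsColimit.hom_ext (isColimit_map H P Q).some h h'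

end Preserves

theorem exists_map_desc (H : Tape C ⥤ D) [PreservesFiniteCoproducts H] (P Q : Tape C) {X : D}
    (f : H.obj P ⟶ X) (g : H.obj Q ⟶ X) :
    ∃ k : H.obj (P ++ Q) ⟶ X, H.map (inl P Q) ≫ k = f ∧ H.map (inr P Q) ≫ k = g :=
  ⟨_, (BinaryCofan.IsColimit.desc' (isColimit_map H P Q).some f g).2⟩

section Extend

variable [PCAEnriched D] {H K : Tape C ⥤ D} [PreservesFiniteCoproducts H]
  (γ : ∀ U : C, H.obj [U] ⟶ K.obj [U])

/-- The extension of a family of arrows from letters to all words. -/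
noncomputable def extendApp : (P : Tape C) → (H.obj P ⟶ K.obj P)
  | [] => PCA.star
  | U :: P => (exists_map_desc H [U] P (X := K.obj ([U] ++ P))
      (γ U ≫ K.map (inl [U] P)) (extendApp P ≫ K.map (inr [U] P))).choose

theorem inl_extendApp_cons (U : C) (P : Tape C) :
    H.map (inl [U] P) ≫ extendApp γ (U :: P) = γ U ≫ K.map (inl [U] P) :=
  (exists_map_desc H [U] P (X := K.obj ([U] ++ P))
    (γ U ≫ K.map (inl [U] P)) (extendApp γ P ≫ K.map (inr [U] P))).choose_spec.1

theorem extendApp_singleton (U : C) : extendApp γ [U] = γ U := by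
  have := inl_extendApp_cons γ U []
  rw [inl_singleton_nil] at this
  have h := H.map_id [U]
  have k := K.map_id [U]
  exact (Category.id_comp _).symm.trans ((congrArg (· ≫ extendApp γ [U]) h).symm.trans
    (this.trans ((congrArg (γ U ≫ ·) k).trans (Category.comp_id _))))

/-- The extended family is natural with respect to an arrow. -/
def IsNaturalAt {P Q : Tape C} (f : P ⟶ Q) : Prop :=
  H.map f ≫ extendApp γ Q = extendApp γ P ≫ K.map f

variable {γ}

theorem IsNaturalAt.comp {P Q R : Tape C} {f : P ⟶ Q} {g : Q ⟶ R} (hf : IsNaturalAt γ f)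
    (hg : IsNaturalAt γ g) : IsNaturalAt γ (f ≫ g) := by
  unfold IsNaturalAt at *
  rw [H.map_comp, K.map_comp, Category.assoc, hg, reassoc_of% hf]

theorem IsNaturalAt.copair {P Q R : Tape C} {f : P ++ Q ⟶ R} (h : IsNaturalAt γ (inl P Q))
    (h' : IsNaturalAt γ (inr P Q)) (hf : IsNaturalAt γ (inl P Q ≫ f))
    (hf' : IsNaturalAt γ (inr P Q ≫ f)) : IsNaturalAt γ f := by
  unfold IsNaturalAt at *
  rw [H.map_comp, K.map_comp, Category.assoc] at hf hf'
  refine map_hom_ext H ?_ ?_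
  · rw [hf, reassoc_of% h]
  · rw [hf', reassoc_of% h']

theorem isNaturalAt_inl_cons (U : C) (P : Tape C) : IsNaturalAt γ (inl [U] P) := by
  refine (inl_extendApp_cons γ U P).trans ?_
  rw [extendApp_singleton]

theorem isNaturalAt_inr_cons (U : C) (P : Tape C) : IsNaturalAt γ (inr [U] P) :=
  (exists_map_desc H [U] P (X := K.obj ([U] ++ P))
    (γ U ≫ K.map (inl [U] P)) (extendApp γ P ≫ K.map (inr [U] P))).choose_spec.2

theorem isNaturalAt_inr (P Q : Tape C) : IsNaturalAt γ (inr P Q) := by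
  induction P with
  | nil =>
    rw [inr_nil, IsNaturalAt]
    simp
  | cons U P ih =>
    rw [inr_cons U P Q]
    exact ih.comp (isNaturalAt_inr_cons U (P ++ Q))

theorem isNaturalAt_inl (P Q : Tape C) : IsNaturalAt γ (inl P Q) := by
  induction P with
  | nil => exact map_from_nil_ext H _ _
  | cons U P ih =>
    refine IsNaturalAt.copair (P := [U]) (Q := P) (isNaturalAt_inl_cons U P)
      (isNaturalAt_inr_cons U P) ?_ ?_
    · exact (inl_cons U P Q).symm ▸ isNaturalAt_inl_cons U (P ++ Q)
    · exact (inr_singleton_inl U P Q).symm ▸ ih.comp (isNaturalAt_inr_cons U (P ++ Q))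

/-- The extended family is natural at injections by construction. Naturality passes through
composition and copairing, and through `star` and convex combinations because both functors are
enriched, so letters are the only real condition. -/
theorem extendApp_naturality (hH : IsPCAFunctor H) (hK : IsPCAFunctor K)
    (hγ : ∀ {U V : C} (c : U ⟶ V), H.map (letter c) ≫ γ V = γ U ≫ K.map (letter c))
    {P Q : Tape C} (f : P ⟶ Q) : IsNaturalAt γ f := by
  refine hom_induction (p := fun P Q f => IsNaturalAt γ f)
    ?_ (fun _ _ hf hg => hf.comp hg) ?_ ?_ isNaturalAt_inl isNaturalAt_inr ?_ ?_ f
  · intro P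
    simp [IsNaturalAt]
  · intro P Q
    rw [IsNaturalAt, hH.map_star, hK.map_star, PCAEnriched.star_comp, PCAEnriched.comp_star]
  · intro P Q r f g hf hg
    unfold IsNaturalAt at *
    rw [hH.map_conv, hK.map_conv, PCAEnriched.conv_comp, PCAEnriched.comp_conv, hf, hg]
  · exact fun f => .copair (isNaturalAt_inl _ _) (isNaturalAt_inr _ _)
  · intro U V c
    have h := extendApp_singleton γ U
    have h' := extendApp_singleton γ V
    exact (congrArg (H.map (letter c) ≫ ·) h').trans
      ((hγ c).trans (congrArg (· ≫ K.map (letter c)) h).symm)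

end Extend

/-- The functor `H` sends each word to a coproduct of the images of its letters, and naturality at
the injections fixes each component there. -/
theorem natTrans_ext {H K : Tape C ⥤ D} [PreservesFiniteCoproducts H] {α β : H ⟶ K}
    (h : ∀ U : C, α.app [U] = β.app [U]) : α = β := by
  ext P
  induction P with
  | nil => exact map_from_nil_ext H _ _
  | cons U P ih =>
    refine map_hom_ext H (P := [U]) (Q := P) ?_ ?_
    · exact (α.naturality _).trans ((congrArg (· ≫ _) (h U)).trans (β.naturality _).symm)
    · exact (α.naturality _).trans ((congrArg (· ≫ _) ih).trans (β.naturality _).symm)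

theorem precompUnit_isEquivalence [PCAEnriched D] [ConvexBiproductCategory D] :
    (precompUnit C D).IsEquivalence where
  faithful := ⟨by
    intro H K α β h
    have := H.property.2
    refine ObjectProperty.hom_ext _ (natTrans_ext fun U => ?_)
    exact congrArg (fun γ => γ.app U) h⟩
  full := ⟨by
    intro H K γ
    have := H.property.2
    refine ⟨ObjectProperty.homMk ⟨extendApp (H := H.obj) (K := K.obj) γ.app, fun P Q f =>
      extendApp_naturality (H := H.obj) H.property.1 K.property.1 (fun c => γ.naturality c) f⟩,
      ?_⟩
    ext U
    exact extendApp_singleton (H := H.obj) (K := K.obj) γ.app U⟩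
  essSurj := ⟨fun F => by
    obtain ⟨S⟩ := SumChoice.exists_of_convexBiproductCategory (D := D)
    exact ⟨⟨S.lift F, (S.wordModel F).functor_isCBFunctor⟩, ⟨eqToIso (S.unit_comp_lift F)⟩⟩⟩

theorem exists_precompUnit_obj_eq [PCAEnriched D] [ConvexBiproductCategory D] (F : C ⥤ D) :
    ∃ H : CBFunctor (Tape C) D, (precompUnit C D).obj H = F := by
  obtain ⟨S⟩ := SumChoice.exists_of_convexBiproductCategory (D := D)
  exact ⟨⟨S.lift F, (S.wordModel F).functor_isCBFunctor⟩, S.unit_comp_lift F⟩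

theorem comp_unit {E : Type u'} [Category.{w} E] (F : C ⥤ E) :
    F ⋙ unit E = unit C ⋙ map F := rfl

end Tape

/-! ## Strict extensions -/

theorem eqToHom_inl {D : Type u'} [Category.{w} D] [StrictSums D] {X X' Y Y' : D} (h : X = X')
    (h' : Y = Y') : eqToHom h ≫ StrictSums.inl X' Y' =
      StrictSums.inl X Y ≫ eqToHom (by rw [h, h']) := by
  subst h h'; simp

theorem eqToHom_inr {D : Type u'} [Category.{w} D] [StrictSums D] {X X' Y Y' : D} (h : X = X')
    (h' : Y = Y') : eqToHom h' ≫ StrictSums.inr X' Y' =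
      StrictSums.inr X Y ≫ eqToHom (by rw [h, h']) := by
  subst h h'; simp

namespace SumChoice

variable {C : Type u} [Category.{v} C] {D : Type u'} [Category.{w} D] [PCAEnriched D]
  [StrictSums D] (F : C ⥤ D)

/-- The interpretation that extends a functor along the strict choice of coproducts. -/
def strictModel : WordModel C D := (ofStrictSums (D := D)).wordModel F

/-- The interpretation leaves out the zero summand after the last letter; strictness of the right
unitor restores the uniform recursion. -/
theorem strictModel_obj_cons (U : C) (P : List C) : (strictModel F).obj (U :: P) =
    StrictSums.sum (F.obj U) ((strictModel F).obj P) := by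
  cases P with
  | nil => exact (StrictSums.sum_zero _).symm
  | cons V P => rfl

theorem strictModel_head (U : C) (P : List C) : (strictModel F).head U P =
    StrictSums.inl (F.obj U) ((strictModel F).obj P) ≫
      eqToHom (strictModel_obj_cons F U P).symm := by
  cases P with
  | nil =>
    have := StrictSums.inl_zero (F.obj U)
    exact ((congrArg (· ≫ eqToHom (StrictSums.sum_zero (F.obj U))) this).trans
      (eqToHom_trans _ _)).symm
  | cons V P => exact (Category.comp_id _).symm

theorem strictModel_tail (U : C) (P : List C) : (strictModel F).tail U P =
    StrictSums.inr (F.obj U) ((strictModel F).obj P) ≫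
      eqToHom (strictModel_obj_cons F U P).symm := by
  cases P with
  | nil => exact (strictModel F).from_nil_ext _ _
  | cons V P => exact (Category.comp_id _).symm

theorem strictModel_obj_append (P Q : List C) : (strictModel F).obj (P ++ Q) =
    StrictSums.sum ((strictModel F).obj P) ((strictModel F).obj Q) := by
  induction P with
  | nil => exact (StrictSums.zero_sum _).symm
  | cons U P ih =>
    rw [List.cons_append, strictModel_obj_cons, strictModel_obj_cons, ih, StrictSums.sum_assoc]

theorem strictModel_inr (P Q : List C) : (strictModel F).inr P Q =
    StrictSums.inr ((strictModel F).obj P) ((strictModel F).obj Q) ≫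
      eqToHom (strictModel_obj_append F P Q).symm := by
  induction P with
  | nil =>
    have := StrictSums.inr_zero ((strictModel F).obj Q)
    exact ((congrArg (· ≫ eqToHom (StrictSums.zero_sum ((strictModel F).obj Q))) this).trans
      (eqToHom_trans _ _)).symm
  | cons U P ih =>
    have h := StrictSums.inr_inr (F.obj U) ((strictModel F).obj P) ((strictModel F).obj Q)
    have e := eqToHom_inr (strictModel_obj_cons F U P) (rfl : (strictModel F).obj Q = _)
    rw [eqToHom_refl, Category.id_comp] at e
    have e' := eqToHom_inr (rfl : F.obj U = _) (strictModel_obj_append F P Q).symm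
    rw [WordModel.inr_cons, ih, strictModel_tail, Category.assoc, reassoc_of% e',
      ← reassoc_of% h, e]
    simp

/-- The injection of a concatenation is built letter by letter. Strict associators identify it with
the chosen injection: `inl_inl` settles the first letter, and `inr_inl` with the induction
hypothesis the rest. -/
theorem strictModel_inl (P Q : List C) : (strictModel F).inl P Q =
    StrictSums.inl ((strictModel F).obj P) ((strictModel F).obj Q) ≫
      eqToHom (strictModel_obj_append F P Q).symm := by
  induction P with
  | nil => exact (strictModel F).from_nil_ext _ _
  | cons U P ih =>
    have h₁ := StrictSums.inl_inl (F.obj U) ((strictModel F).obj P) ((strictModel F).obj Q)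
    have h₂ := StrictSums.inr_inl (F.obj U) ((strictModel F).obj P) ((strictModel F).obj Q)
    have e := eqToHom_inl (strictModel_obj_cons F U P).symm (rfl : (strictModel F).obj Q = _)
    have e₁ := eqToHom_inl (rfl : F.obj U = _) (strictModel_obj_append F P Q).symm
    have e₂ := eqToHom_inr (rfl : F.obj U = _) (strictModel_obj_append F P Q).symm
    rw [eqToHom_refl, Category.id_comp] at e₁
    refine (strictModel F).cons_ext ?_ ?_
    · have k : StrictSums.inl (F.obj U) ((strictModel F).obj (P ++ Q)) ≫
          eqToHom (strictModel_obj_cons F U (P ++ Q)).symm =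
          StrictSums.inl (F.obj U) ((strictModel F).obj P) ≫
            eqToHom (strictModel_obj_cons F U P).symm ≫
              StrictSums.inl ((strictModel F).obj (U :: P)) ((strictModel F).obj Q) ≫
                eqToHom (strictModel_obj_append F (U :: P) Q).symm := by
        rw [reassoc_of% e, e₁, ← h₁]
        simp
      exact ((strictModel F).head_consDesc _ _).trans ((strictModel_head F U (P ++ Q)).trans
        (k.trans ((congrArg (· ≫ _) (strictModel_head F U P)).trans
          (Category.assoc _ _ _)).symm))
    · rw [WordModel.inl_cons, WordModel.tail_consDesc, strictModel_tail, strictModel_tail, ih,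
        Category.assoc, Category.assoc, reassoc_of% e, reassoc_of% e₂, ← reassoc_of% h₂]
      simp

theorem lift_isStrictSumFunctor : IsStrictSumFunctor ((ofStrictSums (D := D)).lift F) where
  obj_zero := rfl
  obj_sum P Q := strictModel_obj_append F P Q
  map_inl P Q := ((strictModel F).functor_map_inl P Q).trans (strictModel_inl F P Q)
  map_inr P Q := ((strictModel F).functor_map_inr P Q).trans (strictModel_inr F P Q)

end SumChoice

/-! ### The adjunction for strict convex biproduct categories -/

namespace Tape

variable {C : Type u} [Category.{v} C] {D : Type u'} [Category.{w} D] [PCAEnriched D]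
  [StrictSums D]

/-- Objects agree because words are strict sums of letters. Arrows agree, up to transport, by
`hom_induction`: the injections are preserved on the nose, and the case of letters is the
hypothesis. -/
theorem strictFunctor_ext {H K : Tape C ⥤ D} (hH : IsPCAFunctor H) (hH' : IsStrictSumFunctor H)
    (hK : IsPCAFunctor K) (hK' : IsStrictSumFunctor K) (h : unit C ⋙ H = unit C ⋙ K) :
    H = K := by
  have := hH'.preservesFiniteCoproducts
  have obj (P : Tape C) : H.obj P = K.obj P := by
    induction P with
    | nil => exact hH'.obj_zero.trans hK'.obj_zero.symm
    | cons U P ih =>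
      refine (hH'.obj_sum [U] P).trans (Eq.trans ?_ (hK'.obj_sum [U] P).symm)
      rw [ih]
      exact congrArg (StrictSums.sum · _) (Functor.congr_obj h U)
  have map_inl (P Q : Tape C) :
      H.map (inl P Q) = eqToHom (obj _) ≫ K.map (inl P Q) ≫ eqToHom (obj _).symm := by
    refine (hH'.map_inl P Q).trans ?_
    rw [show K.map (inl P Q) = _ from hK'.map_inl P Q, Category.assoc,
      reassoc_of% eqToHom_inl (obj P) (obj Q)]
    simp
  have map_inr (P Q : Tape C) :
      H.map (inr P Q) = eqToHom (obj _) ≫ K.map (inr P Q) ≫ eqToHom (obj _).symm := by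
    refine (hH'.map_inr P Q).trans ?_
    rw [show K.map (inr P Q) = _ from hK'.map_inr P Q, Category.assoc,
      reassoc_of% eqToHom_inr (obj P) (obj Q)]
    simp
  refine CategoryTheory.Functor.ext obj fun P Q f => ?_
  refine hom_induction (p := fun P Q f =>
    H.map f = eqToHom (obj P) ≫ K.map f ≫ eqToHom (obj Q).symm)
    ?_ ?_ ?_ ?_ map_inl map_inr ?_ ?_ f
  · intro P
    simp
  · intro P Q R f g hf hg
    simp [hf, hg]
  · intro P Q
    rw [hH.map_star, hK.map_star, PCAEnriched.star_comp, PCAEnriched.comp_star]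
  · intro P Q r f g hf hg
    rw [hH.map_conv, hK.map_conv, PCAEnriched.conv_comp, PCAEnriched.comp_conv, hf, hg]
  · intro P Q R f hf hf'
    refine map_hom_ext H ?_ ?_
    · rw [← H.map_comp, hf, map_inl]
      simp
    · rw [← H.map_comp, hf', map_inr]
      simp
  · intro U V c
    exact Functor.congr_hom h c

/-- The strict morphism that extends a functor. -/
noncomputable def strictLift (D : StrictCBCat.{w, u'}) (F : C ⥤ D.carrier) :
    {H : Tape C ⥤ D.carrier // IsPCAFunctor H ∧ IsStrictSumFunctor H} :=
  ⟨SumChoice.ofStrictSums.lift F, WordModel.functor_isPCAFunctor _,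
    SumChoice.lift_isStrictSumFunctor F⟩

/-- Extension of functors to strict morphisms. -/
noncomputable def strictHomEquiv
    (h : ∀ (C : Type u) [Category.{max u v} C], ConvexBiproductCategory (Tape C))
    (C : Cat.{max u v, u}) (D : StrictCBCat.{max u v, u}) :
    ((strictTapeFunctor.{max u v, u} h).obj C ⟶ D) ≃ (C ⟶ StrictCBCat.forget.obj D) where
  toFun H := (unit C ⋙ H.1).toCatHom
  invFun F := strictLift D F.toFunctor
  left_inv H := Subtype.ext (strictFunctor_ext (strictLift D _).2.1 (strictLift D _).2.2
    H.2.1 H.2.2 rfl)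
  right_inv _ := rfl

/-- The tape functor is left adjoint to the forgetful functor of strict convex biproduct
categories. -/
noncomputable def strictAdjunction
    (h : ∀ (C : Type u) [Category.{max u v} C], ConvexBiproductCategory (Tape C)) :
    strictTapeFunctor.{max u v, u} h ⊣ StrictCBCat.forget.{max u v, u} :=
  Adjunction.mkOfHomEquiv
    { homEquiv := strictHomEquiv.{v, u} h
      homEquiv_naturality_left_symm := fun f g => by
        -- Restriction along the unit is natural by definition, so the equation for its inverse is
        -- compared after restriction.
        apply (strictHomEquiv.{v, u} h _ _).injective
        rw [Equiv.apply_symm_apply]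
        rfl
      homEquiv_naturality_right := fun f g => rfl }

end Tape

/-- The assignment `C ↦ T(C)` is a functor from categories to convex biproduct categories which is
left adjoint to the forgetful functor: every `T(C)` is a convex biproduct category (and has small
hom-sets relative to those of `C`); the units `η_C : C ⥤ T(C)` are natural, and precomposition
with `η_C` is an equivalence from the category of morphisms of convex biproduct categories
`T(C) ⥤ D` to the category of functors from `C` to the underlying category of `D`, with every
functor extending on the nose. On strict convex biproduct categories and strict morphisms this is
an adjunction of ordinary functors, with the same unit. -/
theorem mainTheorem3 :
    (∃ h : ∀ (C : Type u) [Category.{v} C], ConvexBiproductCategory (Tape C),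
      (∀ (C : Type u) [Category.{v} C], LocallySmall.{v} (Tape C)) ∧
      (∀ (C D : Cat.{v, u}) (F : C ⟶ D),
        F.toFunctor ⋙ Tape.unit D = Tape.unit C ⋙ ((tapeFunctor.{v, u} h).map F).obj) ∧
      (∀ (C : Cat.{v, u}) (D : CBCat.{w, u'}),
        (Tape.precompUnit C D.carrier).IsEquivalence ∧
        ∀ F : C ⥤ D.carrier, ∃ H : CBFunctor (Tape C) D.carrier,
          (Tape.precompUnit C D.carrier).obj H = F)) ∧
    (∃ h : ∀ (C : Type u) [Category.{max u v} C], ConvexBiproductCategory (Tape C),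
      strictTapeFunctor.{max u v, u} h ⋙ StrictCBCat.toCBCat = tapeFunctor.{max u v, u} h ∧
      ∃ adj : strictTapeFunctor.{max u v, u} h ⊣ StrictCBCat.forget.{max u v, u},
        ∀ C : Cat.{max u v, u}, adj.unit.app C = (Tape.unit C).toCatHom) := by
  -- The adjunction of ordinary functors uses arrows in `max u v`, where `T(C)` stays in the
  -- universe levels of `C` and the two functors run between the same categories. Its unit is the
  -- restriction of the identity along `Tape.unit`, hence the required one by definition.
  refine ⟨⟨fun C _ => Tape.convexBiproductCategory, fun C _ => Tape.locallySmall,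
    fun C D F => Tape.comp_unit F.toFunctor, fun C D => ⟨Tape.precompUnit_isEquivalence,
      Tape.exists_precompUnit_obj_eq⟩⟩, ⟨fun C _ => Tape.convexBiproductCategory, rfl,
    Tape.strictAdjunction.{v, u} _, fun C => rfl⟩⟩
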